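/- **Proposition (wave-function lifting in 2D).** There is a function $C:[0,\infty)^2\to[0,\infty)$ with the following property. Let $M_1\ge 0$, let $\sqrt\rho\in H^1(\mathbf R^2)$ be a non-negative continuous function and let $\Lambda\in L^2(\mathbf R^2;\mathbf R^2)$, with $$\|\sqrt\rho\|_{H^1(\mathbf R^2)}+\|\Lambda\|_{L^2(\mathbf R^2)}\le M_1 .$$ Put $\rho=(\sqrt\rho)^2$, $J=\sqrt\rho\,\Lambda$, and assume: (i) (isolated point vacuum) there is $\alpha>0$ such that any two distinct points of $V=\{x:\rho(x)=0\}$ have distance at least $\alpha$; (ii) (quantised vorticity) the velocity field $v=J/\rho$, which is defined and locally integrable on $\mathbf R^2\setminus V$, is a distribution $v\in D'(\mathbf R^2;\mathbf R^2)$ (that is, some $v\in D'(\mathbf R^2;\mathbf R^2)$ coincides with the function $J/\rho$ on $\mathbf R^2\setminus V$; for instance $J/\rho\in L^1_{loc}(\mathbf R^2)$), and there are integers $k_x$, $x\in V$, with $$\nabla\wedge v=\partial_{x_1}v_2-\partial_{x_2}v_1=2\pi\sum_{x\in V}k_x\delta_x\quad\text{in } D'(\mathbf R^2).$$ Then there is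 $\psi\in H^1(\mathbf R^2;\mathbf C)$ such that, almost everywhere, $$|\psi|=\sqrt\rho,\qquad \Lambda=\operatorname{Im}(\bar\phi\,\nabla\psi)$$ for some polar factor $\phi$ of $\psi$, i.e. some $\phi\in L^\infty(\mathbf R^2;\mathbf C)$ with $\|\phi\|_{L^\infty}\le1$ and $|\psi|\phi=\psi$ a.e. Moreover, if $\triangle\rho\in L^1_{loc}(\mathbf R^2)$ and, for some $M_2\ge0$, $$\Big\|\frac{\Lambda_j^2}{\sqrt\rho}-\partial_{x_j}^2\sqrt\rho\Big\|_{L^2(\mathbf R^2)}+\Big\|\frac{\partial_{x_j}J_j}{\sqrt\rho}\Big\|_{L^2(\mathbf R^2)}\le M_2,\qquad j=1,2,$$ where $\partial_{x_j}^2\sqrt\rho$ and $\partial_{x_j}J_j$ are weak derivatives on $\mathbf R^2\setminus V$ that are locally integrable functions there, then this same $\psi$ belongs to $H^2(\mathbf R^2)$ and $$\|\psi\|_{H^2(\mathbf R^2)}\le C(M_1,M_2).$$ Here $\|f\|_{H^k}=\sum_{i=0}^k\|\nabla^i f\|_{L^2}$. -/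

import Mathlib

open MeasureTheory
open scoped ENNReal NNReal ContDiff

/-- The Euclidean plane. -/
abbrev Plane : Type := EuclideanSpace ℝ (Fin 2)

/-- The standard basis vector `e i` of the plane. -/
noncomputable def Plane.e (i : Fin 2) : Plane := EuclideanSpace.single i (1 : ℝ)

/-- `g` is the weak partial derivative `∂ᵢ f` on the (open) set `Ω`: both functions are locally
integrable on `Ω` and `∫ (∂ᵢ η) f = - ∫ η g` for all `η ∈ C_c^∞(Ω)`. -/
structure HasWeakPartial {𝕜 : Type*} [RCLike 𝕜] (Ω : Set Plane) (i : Fin 2)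
    (f g : Plane → 𝕜) : Prop where
  locallyIntegrableOn : LocallyIntegrableOn f Ω volume
  locallyIntegrableOn_deriv : LocallyIntegrableOn g Ω volume
  integral_eq : ∀ η : Plane → ℝ, ContDiff ℝ ∞ η → HasCompactSupport η → tsupport η ⊆ Ω →
    ∫ x, (fderiv ℝ η x (Plane.e i)) • f x = - ∫ x, η x • g x

/-- `f ∈ H¹(ℝ²)` with weak gradient `Df`. -/
structure IsH1 {𝕜 : Type*} [RCLike 𝕜] (f : Plane → 𝕜)
    (Df : Plane → EuclideanSpace 𝕜 (Fin 2)) : Prop where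
  memLp : MemLp f 2 volume
  memLp_grad : MemLp Df 2 volume
  hasWeakPartial : ∀ i, HasWeakPartial Set.univ i f (fun x => Df x i)

/-- `f ∈ H²(ℝ²)` with weak gradient `Df` and weak Hessian `D2f`; the entry `(i, j)` is
`∂ᵢ ∂ⱼ f`, and the pointwise norm of the Hessian is the Frobenius norm. -/
structure IsH2 {𝕜 : Type*} [RCLike 𝕜] (f : Plane → 𝕜)
    (Df : Plane → EuclideanSpace 𝕜 (Fin 2))
    (D2f : Plane → EuclideanSpace 𝕜 (Fin 2 × Fin 2)) : Prop where
  isH1 : IsH1 f Df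
  memLp_hess : MemLp D2f 2 volume
  hasWeakPartial : ∀ i j,
    HasWeakPartial Set.univ i (fun x => Df x j) (fun x => D2f x (i, j))

/-- The norm `‖f‖_{L²} + ‖∇f‖_{L²}` of `H¹(ℝ²)`, where `Df = ∇f`. -/
noncomputable def normH1 {𝕜 : Type*} [RCLike 𝕜] (f : Plane → 𝕜)
    (Df : Plane → EuclideanSpace 𝕜 (Fin 2)) : ℝ≥0∞ :=
  eLpNorm f 2 volume + eLpNorm Df 2 volume

/-- The norm `‖f‖_{L²} + ‖∇f‖_{L²} + ‖∇²f‖_{L²}` of `H²(ℝ²)`, where `Df = ∇f`, `D2f = ∇²f`. -/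
noncomputable def normH2 {𝕜 : Type*} [RCLike 𝕜] (f : Plane → 𝕜)
    (Df : Plane → EuclideanSpace 𝕜 (Fin 2))
    (D2f : Plane → EuclideanSpace 𝕜 (Fin 2 × Fin 2)) : ℝ≥0∞ :=
  eLpNorm f 2 volume + eLpNorm Df 2 volume + eLpNorm D2f 2 volume

/-- The set `P(ψ)` of polar factors of `ψ`: `‖φ‖_{L^∞} ≤ 1` and `|ψ| φ = ψ` a.e. -/
def polarFactors (ψ : Plane → ℂ) : Set (Plane → ℂ) :=
  {φ | MemLp φ ∞ volume ∧ eLpNorm φ ∞ volume ≤ 1 ∧ ∀ᵐ x, (‖ψ x‖ : ℂ) * φ x = ψ x}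

section Hydrodynamics

/-! The hydrodynamic data are `r = √ρ` and `Λ`, with `ρ = r²` and `J = r Λ`. -/

/-- The vacuum `V = {ρ = 0}`. -/
def vacuum (r : Plane → ℝ) : Set Plane := {x | r x = 0}

/-- The momentum density `J = √ρ Λ`. -/
noncomputable def momentum (r : Plane → ℝ) (Λ : Plane → Plane) (x : Plane) : Plane :=
  r x • Λ x

/-- The velocity `v = J / ρ`, meaningful outside the vacuum. -/
noncomputable def velocity (r : Plane → ℝ) (Λ : Plane → Plane) (x : Plane) : Plane :=
  (r x ^ 2)⁻¹ • momentum r Λ x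

/-- Distinct vacuum points have a uniformly positive mutual distance. -/
def HasSeparatedPointVacuum (r : Plane → ℝ) : Prop :=
  ∃ α : ℝ, 0 < α ∧ ∀ x ∈ vacuum r, ∀ y ∈ vacuum r, x ≠ y → α ≤ dist x y

open scoped Distributions LineDeriv in
/-- Quantised vorticity. The velocity field is a vector-valued distribution `v ∈ D'(ℝ²)`, given by
the function `J / ρ` off the vacuum (where that function is locally integrable), and
`∂₁ v₂ - ∂₂ v₁ = 2π ∑_{x ∈ V} k_x δ_x` in `D'(ℝ²)` with integers `k_x`. If `J / ρ` is locally
integrable on the whole plane, the distribution defined by it is such a `v`. The sum over `V`,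
evaluated at a test function, has finitely many non-zero terms when `V` is separated. -/
def HasQuantisedVorticity (r : Plane → ℝ) (Λ : Plane → Plane) : Prop :=
  ∃ v : 𝓓'((⊤ : TopologicalSpace.Opens Plane), Plane),
    (∀ η : 𝓓((⊤ : TopologicalSpace.Opens Plane), ℝ), Disjoint (tsupport η) (vacuum r) →
      v η = ∫ x, η x • velocity r Λ x) ∧
    ∃ k : vacuum r → ℤ, ∀ η : 𝓓((⊤ : TopologicalSpace.Opens Plane), ℝ),
      (∂_{Plane.e 0} v) η 1 - (∂_{Plane.e 1} v) η 0 =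
        2 * Real.pi * ∑ᶠ x : vacuum r, (k x : ℝ) * η x

/-- The higher order condition: `Δρ ∈ L¹_loc(ℝ²)` (in the sense of distributions), and for
`j = 1, 2`
`‖Λⱼ² / √ρ - ∂ⱼ² √ρ‖_{L²} + ‖∂ⱼ Jⱼ / √ρ‖_{L²} ≤ M₂`,
the derivatives `d = ∂ⱼ² √ρ` and `m = ∂ⱼ Jⱼ` being weak derivatives off the vacuum, hence defined
almost everywhere when the vacuum is separated. Here `Dr = ∇√ρ`. -/
structure HasHigherOrderBound (r : Plane → ℝ) (Dr Λ : Plane → Plane) (M₂ : ℝ≥0) : Prop where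
  laplacian : ∃ L : Plane → ℝ, LocallyIntegrable L volume ∧
    ∀ η : Plane → ℝ, ContDiff ℝ ∞ η → HasCompactSupport η →
      ∫ x, Laplacian.laplacian η x * r x ^ 2 = ∫ x, η x * L x
  bound : ∀ j : Fin 2, ∃ d m : Plane → ℝ,
    HasWeakPartial (vacuum r)ᶜ j (fun x => Dr x j) d ∧
    HasWeakPartial (vacuum r)ᶜ j (fun x => momentum r Λ x j) m ∧
    eLpNorm (fun x => Λ x j ^ 2 / r x - d x) 2 volume
      + eLpNorm (fun x => m x / r x) 2 volume ≤ M₂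

end Hydrodynamics

open Set Filter Topology

/-!
Write `r = √ρ`. The wave function is `ψ = r φ`, where `φ = exp(iθ)` and `∇θ = v` off the vacuum `V`.

The phase `θ` is multivalued, and its jumps are removed first. There is an integer-valued function
`n` with `∂₀∂₁ n = ∑ k_x δ_x`; up to functions of one variable it counts the vacuum points to the
lower left of a point. Then `v + 2π (∂₀ n, 0)` is curl-free, so it is the gradient of a linear
functional on test functions: a gradient prescribes a functional on divergences, consistently
because a divergence-free pair of test functions is a rotated gradient. Off `V` the functional is a
function `F`, and `∂₀(F - 2π n) = v₀`, `∂₁ F = v₁`. Hence `φ = exp(iF)`, which does not see `2π n`,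
satisfies `∂ⱼ φ = i vⱼ φ` off `V`.

The product rule now gives, off `V`, `∂ⱼ(r φ) = (∂ⱼ r + i Λⱼ) φ` and
`∂ⱼ²(r φ) = (-(Λⱼ² / r - ∂ⱼ² r) + i ∂ⱼ Jⱼ / r) φ`. Both extend across `V`: weak differentiability is
absolute continuity on almost every line parallel to an axis, and almost every line misses `V`. The
mixed second derivative is bounded by the pure ones through the Fourier transform.
-/

/-! ### Coordinates and rectangles -/

namespace Plane

theorem add_one_ne (i : Fin 2) : i + 1 ≠ i := by decide +revert

theorem eq_or_eq_add_one (i k : Fin 2) : k = i ∨ k = i + 1 := by decide +revert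

/-- Coordinates of the plane adapted to the direction `i`: the point whose `i`-th coordinate is
`p.2` and whose other coordinate, of index `i + 1`, is `p.1`. -/
noncomputable def chart (i : Fin 2) : (ℝ × ℝ) ≃L[ℝ] Plane :=
  LinearEquiv.toContinuousLinearEquiv
    { toFun := fun p => WithLp.toLp 2 fun k => if k = i then p.2 else p.1
      invFun := fun x => (x (i + 1), x i)
      map_add' := fun p q => by ext k; by_cases h : k = i <;> simp [h]
      map_smul' := fun c p => by ext k; by_cases h : k = i <;> simp [h]
      left_inv := fun p => by simp [add_one_ne i]
      right_inv := fun x => by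
        ext k
        obtain rfl | rfl := eq_or_eq_add_one i k <;> simp }

theorem chart_apply (i : Fin 2) (p : ℝ × ℝ) (k : Fin 2) :
    chart i p k = if k = i then p.2 else p.1 := rfl

@[simp]
theorem chart_apply_self (i : Fin 2) (p : ℝ × ℝ) : chart i p i = p.2 := by simp [chart_apply]

@[simp]
theorem chart_apply_add_one (i : Fin 2) (p : ℝ × ℝ) : chart i p (i + 1) = p.1 := by
  simp [chart_apply]

@[simp]
theorem chart_coords (i : Fin 2) (x : Plane) : chart i (x (i + 1), x i) = x :=
  (chart i).apply_symm_apply x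

theorem chart_zero_one (i : Fin 2) : chart i (0, 1) = e i := by
  ext k
  by_cases h : k = i <;> simp [chart_apply, e, h]

theorem measurePreserving_chart (i : Fin 2) : MeasurePreserving (chart i) volume volume := by
  have h : MeasurePreserving (fun p : ℝ × ℝ =>
      (WithLp.toLp 2 ((MeasurableEquiv.finTwoArrow (α := ℝ)).symm p) : Plane)) volume volume :=
    (PiLp.volume_preserving_toLp (Fin 2)).comp (volume_preserving_finTwoArrow ℝ).symm
  fin_cases i
  · have hswap : MeasurePreserving (Prod.swap : ℝ × ℝ → ℝ × ℝ) volume volume :=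
      Measure.measurePreserving_swap
    convert h.comp hswap using 1
    ext p k
    fin_cases k <;> simp [chart_apply, MeasurableEquiv.finTwoArrow]
  · convert h using 1
    ext p k
    fin_cases k <;> simp [chart_apply, MeasurableEquiv.finTwoArrow]

section Slices

variable {F : Type*} [NormedAddCommGroup F] {f : Plane → F}

theorem integrable_chart (i : Fin 2) : Integrable (fun p => f (chart i p)) ↔ Integrable f :=
  (measurePreserving_chart i).integrable_comp_emb (chart i).toHomeomorph.measurableEmbedding

theorem ae_integrable_slice (hf : Integrable f) (i : Fin 2) :
    ∀ᵐ s, Integrable fun t => f (chart i (s, t)) :=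
  ((integrable_chart i).2 hf).prod_right_ae

theorem integral_eq_integral_integral [NormedSpace ℝ F] (hf : Integrable f) (i : Fin 2) :
    ∫ x, f x = ∫ s, ∫ t, f (chart i (s, t)) := by
  rw [← (measurePreserving_chart i).integral_comp (chart i).toHomeomorph.measurableEmbedding]
  exact integral_prod _ ((integrable_chart i).2 hf)

theorem ae_chart {P : Plane → Prop} (h : ∀ᵐ x, P x) (i : Fin 2) :
    ∀ᵐ s : ℝ, ∀ᵐ t : ℝ, P (chart i (s, t)) :=
  Measure.ae_ae_of_ae_prod ((measurePreserving_chart i).quasiMeasurePreserving.ae h)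

end Slices

theorem hasDerivAt_comp_chart {F : Type*} [NormedAddCommGroup F] [NormedSpace ℝ F] {f : Plane → F}
    (hf : Differentiable ℝ f) (i : Fin 2) (s t : ℝ) :
    HasDerivAt (fun t => f (chart i (s, t))) (fderiv ℝ f (chart i (s, t)) (e i)) t := by
  have h : HasDerivAt (fun t => chart i (s, t)) (e i) t := by
    rw [← chart_zero_one]
    exact (chart i).hasFDerivAt.comp_hasDerivAt t ((hasDerivAt_const t s).prodMk (hasDerivAt_id t))
  exact (hf _).hasFDerivAt.comp_hasDerivAt t h

/-- The open coordinate rectangle with corners `a` and `b`. -/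
def box (a b : Fin 2 → ℝ) : Set Plane := {x | ∀ i, x i ∈ Ioo (a i) (b i)}

/-- The closed coordinate rectangle with corners `a` and `b`. -/
def closedBox (a b : Fin 2 → ℝ) : Set Plane := {x | ∀ i, x i ∈ Icc (a i) (b i)}

variable {a b : Fin 2 → ℝ}

theorem isOpen_box : IsOpen (box a b) := by
  simp only [box, ofPred_forall]
  exact isOpen_iInter_of_finite fun i => isOpen_Ioo.preimage (by fun_prop)

theorem isCompact_closedBox : IsCompact (closedBox a b) := by
  convert (PiLp.homeomorph 2 fun _ : Fin 2 => ℝ).isCompact_preimage.2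
    (isCompact_Icc (a := a) (b := b)) using 1
  ext x
  exact forall_and

theorem box_subset_closedBox : box a b ⊆ closedBox a b :=
  fun _ hx i => Ioo_subset_Icc_self (hx i)

theorem forall_iff (i : Fin 2) {P : Fin 2 → Prop} : (∀ k, P k) ↔ P (i + 1) ∧ P i :=
  ⟨fun h => ⟨h _, h _⟩, fun h k => by obtain rfl | rfl := eq_or_eq_add_one i k <;> tauto⟩

theorem chart_mem_box {i : Fin 2} {p : ℝ × ℝ} :
    chart i p ∈ box a b ↔ p.1 ∈ Ioo (a (i + 1)) (b (i + 1)) ∧ p.2 ∈ Ioo (a i) (b i) := by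
  rw [box, mem_ofPred_eq, forall_iff i, chart_apply_self, chart_apply_add_one]

theorem exists_mem_box_of_mem_isOpen {Ω : Set Plane} (hΩ : IsOpen Ω) {x : Plane} (hx : x ∈ Ω) :
    ∃ a b : Fin 2 → ℝ, x ∈ box a b ∧ closedBox a b ⊆ Ω := by
  have hΩ' : WithLp.toLp 2 ⁻¹' Ω ∈ 𝓝 (WithLp.ofLp x) :=
    (hΩ.preimage (PiLp.continuous_toLp 2 _)).mem_nhds hx
  obtain ⟨ε, hε, hsub⟩ := Metric.nhds_basis_closedBall.mem_iff.1 hΩ'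
  refine ⟨fun i => x i - ε, fun i => x i + ε, fun i => ⟨by linarith, by linarith⟩,
    fun y hy => hsub (a := WithLp.ofLp y) ((dist_pi_le_iff hε.le).2 fun i => ?_)⟩
  rw [Real.dist_eq, abs_le]
  constructor <;> linarith [(hy i).1, (hy i).2]

theorem exists_subset_box {K : Set Plane} (hK : IsCompact K) :
    ∃ M : ℝ, 0 < M ∧ K ⊆ box (fun _ => -M) fun _ => M := by
  obtain ⟨M, hM, hsub⟩ := hK.isBounded.subset_ball_lt 0 0
  refine ⟨M, hM, fun x hx i => abs_lt.1 ?_⟩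
  exact (PiLp.norm_apply_le x i).trans_lt (mem_ball_zero_iff.1 (hsub hx))

end Plane

/-! ### Test functions -/

/-- `η` is a test function supported in `Ω`. -/
structure IsTest (Ω : Set Plane) (η : Plane → ℝ) : Prop where
  contDiff : ContDiff ℝ ∞ η
  hasCompactSupport : HasCompactSupport η
  tsupport_subset : tsupport η ⊆ Ω

namespace IsTest

open Plane

variable {Ω Ω' : Set Plane} {η ζ : Plane → ℝ}

theorem of_support_subset {K : Set Plane} (hK : IsCompact K) (hKΩ : K ⊆ Ω) (hη : ContDiff ℝ ∞ η)
    (hs : Function.support η ⊆ K) : IsTest Ω η :=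
  have hsub : tsupport η ⊆ K := closure_minimal hs hK.isClosed
  ⟨hη, hK.of_isClosed_subset (isClosed_tsupport η) hsub, hsub.trans hKΩ⟩

theorem differentiable (h : IsTest Ω η) : Differentiable ℝ η :=
  h.contDiff.differentiable (by simp)

theorem continuous (h : IsTest Ω η) : Continuous η := h.contDiff.continuous

theorem integrable (h : IsTest Ω η) : Integrable η :=
  h.continuous.integrable_of_hasCompactSupport h.hasCompactSupport

theorem eq_zero_of_notMem (h : IsTest Ω η) {x : Plane} (hx : x ∉ Ω) : η x = 0 :=
  image_eq_zero_of_notMem_tsupport fun h' => hx (h.tsupport_subset h')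

theorem mul_indicator (h : IsTest Ω η) (u : Plane → ℝ) (x : Plane) :
    η x * Ω.indicator u x = η x * u x := by
  by_cases hx : x ∈ Ω
  · rw [indicator_of_mem hx]
  · rw [h.eq_zero_of_notMem hx, zero_mul, zero_mul]

theorem setIntegral_mul (h : IsTest Ω η) (u : Plane → ℝ) :
    ∫ x in Ω, η x * u x = ∫ x, η x * u x :=
  setIntegral_eq_integral_of_forall_compl_eq_zero fun x hx => by
    rw [h.eq_zero_of_notMem hx, zero_mul]

theorem mono (h : IsTest Ω η) (hΩ : Ω ⊆ Ω') : IsTest Ω' η :=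
  ⟨h.contDiff, h.hasCompactSupport, h.tsupport_subset.trans hΩ⟩

theorem fderiv_apply (h : IsTest Ω η) (v : Plane) : IsTest Ω fun x => fderiv ℝ η x v where
  contDiff := (h.contDiff.fderiv_right (m := ∞) (by simp)).clm_apply contDiff_const
  hasCompactSupport := h.hasCompactSupport.fderiv_apply ℝ v
  tsupport_subset := (tsupport_fderiv_apply_subset ℝ v).trans h.tsupport_subset

theorem mul_left (h : IsTest Ω η) (hζ : ContDiff ℝ ∞ ζ) : IsTest Ω fun x => ζ x * η x where
  contDiff := hζ.mul h.contDiff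
  hasCompactSupport := h.hasCompactSupport.mul_left
  tsupport_subset := (closure_mono (Function.support_mul_subset_right ζ η)).trans h.tsupport_subset

theorem sub (h : IsTest Ω η) (hζ : IsTest Ω ζ) : IsTest Ω fun x => η x - ζ x :=
  of_support_subset (h.hasCompactSupport.isCompact.union hζ.hasCompactSupport.isCompact)
    (union_subset h.tsupport_subset hζ.tsupport_subset) (h.contDiff.sub hζ.contDiff)
    ((Function.support_sub η ζ).trans (union_subset_union subset_closure subset_closure))

theorem integrable_smul {F : Type*} [NormedAddCommGroup F] [NormedSpace ℝ F] {u : Plane → F}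
    (h : IsTest Ω η) (hu : LocallyIntegrableOn u Ω) : Integrable fun x => η x • u x := by
  obtain ⟨C, hC⟩ := h.hasCompactSupport.exists_bound_of_continuous h.continuous
  refine IntegrableOn.integrable_of_forall_notMem_eq_zero (s := tsupport η) ?_ fun x hx => by
    rw [image_eq_zero_of_notMem_tsupport hx, zero_smul]
  exact (hu.integrableOn_compact_subset h.tsupport_subset h.hasCompactSupport.isCompact).bdd_smul C
    h.continuous.aestronglyMeasurable (Eventually.of_forall hC)

theorem contDiff_slice (h : IsTest Ω η) (i : Fin 2) (s : ℝ) :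
    ContDiff ℝ ∞ fun t => η (chart i (s, t)) :=
  h.contDiff.comp ((chart i).contDiff.comp (contDiff_prodMk_right s))

theorem hasCompactSupport_slice (h : IsTest Ω η) (i : Fin 2) (s : ℝ) :
    HasCompactSupport fun t => η (chart i (s, t)) :=
  HasCompactSupport.intro (h.hasCompactSupport.isCompact.image (f := fun x => x i) (by fun_prop))
    fun t ht => image_eq_zero_of_notMem_tsupport fun hx => ht ⟨_, hx, by simp⟩

theorem integrable_slice (h : IsTest Ω η) (i : Fin 2) (s : ℝ) :
    Integrable fun t => η (chart i (s, t)) :=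
  (h.contDiff_slice i s).continuous.integrable_of_hasCompactSupport (h.hasCompactSupport_slice i s)

theorem deriv_slice (h : IsTest Ω η) (i : Fin 2) (s t : ℝ) :
    deriv (fun t => η (chart i (s, t))) t = fderiv ℝ η (chart i (s, t)) (e i) :=
  (hasDerivAt_comp_chart h.differentiable i s t).deriv

end IsTest

/-! ### Primitives and averages along lines -/

theorem exists_Icc_of_isCompact_subset_Ioo {K : Set ℝ} (hK : IsCompact K) {a b : ℝ}
    (h : K ⊆ Ioo a b) : ∃ c d, K ⊆ Icc c d ∧ Icc c d ⊆ Ioo a b := by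
  rcases K.eq_empty_or_nonempty with rfl | hne
  · exact ⟨1, 0, empty_subset _, by simp⟩
  · obtain ⟨c, hc, hc'⟩ := hK.exists_isLeast hne
    obtain ⟨d, hd, hd'⟩ := hK.exists_isGreatest hne
    exact ⟨c, d, fun t ht => ⟨hc' ht, hd' ht⟩, Icc_subset_Ioo (h hc).1 (h hd).2⟩

/-- `β` is a smooth function with integral one and compact support in `(a, b)`, a profile along
which mass is redistributed in one coordinate direction. -/
structure IsProfile (a b : ℝ) (β : ℝ → ℝ) : Prop where
  contDiff : ContDiff ℝ ∞ β
  hasCompactSupport : HasCompactSupport β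
  tsupport_subset : tsupport β ⊆ Ioo a b
  integral_eq_one : ∫ t, β t = 1

theorem exists_isProfile {a b : ℝ} (hab : a < b) : ∃ β, IsProfile a b β := by
  let f : ContDiffBump ((a + b) / 2) :=
    { rIn := (b - a) / 8, rOut := (b - a) / 4, rIn_pos := by linarith, rIn_lt_rOut := by linarith }
  refine ⟨f.normed volume, f.contDiff_normed, f.hasCompactSupport_normed, ?_, f.integral_normed⟩
  rw [f.tsupport_normed_eq, Real.closedBall_eq_Icc]
  exact Icc_subset_Ioo (by simp only [f]; linarith) (by simp only [f]; linarith)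

theorem IsProfile.integrable {a b : ℝ} {β : ℝ → ℝ} (hβ : IsProfile a b β) : Integrable β :=
  hβ.contDiff.continuous.integrable_of_hasCompactSupport hβ.hasCompactSupport

namespace Plane

/-- The primitive of `g` in direction `i`, from `-∞`. -/
noncomputable def linePrimitive (i : Fin 2) (g : Plane → ℝ) (x : Plane) : ℝ :=
  ∫ τ in Iic (x i), g (chart i (x (i + 1), τ))

/-- The average of `η` along lines in direction `i`, redistributed along each line according to
the profile `β`. -/
noncomputable def lineAverage (i : Fin 2) (β : ℝ → ℝ) (η : Plane → ℝ) (x : Plane) : ℝ :=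
  (∫ t, η (chart i (x (i + 1), t))) * β (x i)

/-- The integral of `W` against `β` along lines in direction `i`; this is the transpose of
`lineAverage i β`. -/
noncomputable def lineMoment (i : Fin 2) (β : ℝ → ℝ) (W : Plane → ℝ) (s : ℝ) : ℝ :=
  ∫ t, β t * W (chart i (s, t))

@[simp]
theorem linePrimitive_chart (i : Fin 2) (g : Plane → ℝ) (s t : ℝ) :
    linePrimitive i g (chart i (s, t)) = ∫ τ in Iic t, g (chart i (s, τ)) := by
  simp [linePrimitive]

@[simp]
theorem lineAverage_chart (i : Fin 2) (β : ℝ → ℝ) (η : Plane → ℝ) (s t : ℝ) :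
    lineAverage i β η (chart i (s, t)) = (∫ t, η (chart i (s, t))) * β t := by
  simp [lineAverage]

variable {a b : Fin 2 → ℝ}

theorem integrableOn_box_iff (i : Fin 2) {f : Plane → ℝ} :
    IntegrableOn f (box a b) ↔ Integrable (fun p => f (chart i p))
      ((volume.restrict (Ioo (a (i + 1)) (b (i + 1)))).prod
        (volume.restrict (Ioo (a i) (b i)))) := by
  rw [← (measurePreserving_chart i).integrableOn_comp_preimage
    (chart i).toHomeomorph.measurableEmbedding, Measure.prod_restrict, IntegrableOn]
  congr! 2
  ext p
  exact chart_mem_box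

theorem setIntegral_box (i : Fin 2) {f : Plane → ℝ} (hf : IntegrableOn f (box a b)) :
    ∫ x in box a b, f x =
      ∫ s in Ioo (a (i + 1)) (b (i + 1)), ∫ t in Ioo (a i) (b i), f (chart i (s, t)) := by
  rw [← integral_prod _ ((integrableOn_box_iff i).1 hf), Measure.prod_restrict,
    ← (measurePreserving_chart i).setIntegral_preimage_emb
      (chart i).toHomeomorph.measurableEmbedding]
  congr! 2
  ext p
  exact chart_mem_box

theorem ae_restrict_box_chart {P : Plane → Prop} (h : ∀ᵐ x ∂volume.restrict (box a b), P x)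
    (i : Fin 2) : ∀ᵐ s ∂volume.restrict (Ioo (a (i + 1)) (b (i + 1))),
      ∀ᵐ t ∂volume.restrict (Ioo (a i) (b i)), P (chart i (s, t)) := by
  rw [ae_restrict_iff' isOpen_box.measurableSet] at h
  rw [ae_restrict_iff' measurableSet_Ioo]
  filter_upwards [ae_chart h i] with s hs hsI
  rw [ae_restrict_iff' measurableSet_Ioo]
  filter_upwards [hs] with t ht htI using ht (chart_mem_box.2 ⟨hsI, htI⟩)

theorem integrableOn_comp_coord (i : Fin 2) {w : ℝ → ℝ} (hw : Integrable w) :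
    IntegrableOn (fun x : Plane => w (x (i + 1))) (box a b) := by
  rw [integrableOn_box_iff i]
  simpa only [chart_apply_add_one] using hw.restrict.comp_fst (volume.restrict (Ioo (a i) (b i)))

theorem integrableOn_linePrimitive (i : Fin 2) {g : Plane → ℝ} (hg : Integrable g) :
    IntegrableOn (linePrimitive i g) (box a b) := by
  rw [integrableOn_box_iff i, Measure.prod_restrict]
  set ν : Measure ℝ := volume.restrict (Ioo (a i) (b i))
  have h1 : Integrable (fun q : ℝ × ℝ × ℝ => g (chart i q.2)) (ν.prod volume) :=
    ((integrable_chart i).2 hg).comp_snd ν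
  have h2 : Integrable ({q : ℝ × ℝ × ℝ | q.2.2 ≤ q.1}.indicator fun q => g (chart i q.2))
      (ν.prod volume) := h1.indicator (measurableSet_le (by fun_prop) (by fun_prop))
  have h3 : Integrable (fun p : ℝ × ℝ => linePrimitive i g (chart i (p.2, p.1)))
      (ν.prod volume) := by
    convert ((measurePreserving_prodAssoc ν volume volume).integrable_comp_emb
      MeasurableEquiv.prodAssoc.measurableEmbedding |>.2 h2).integral_prod_left using 2 with p
    rw [linePrimitive_chart, ← integral_indicator measurableSet_Iic]
    rfl
  rw [← Measure.prod_restrict]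
  exact h3.swap.mono_measure (Measure.prod_mono Measure.restrict_le_self le_rfl)

end Plane

namespace IsTest

open Plane

variable {Ω : Set Plane} {η : Plane → ℝ} {a b : Fin 2 → ℝ} {i : Fin 2} {β : ℝ → ℝ}

theorem contDiff_integral_comp_sub_mul (h : IsTest Ω η) (i : Fin 2) {f : ℝ → ℝ}
    (hf : LocallyIntegrable f) :
    ContDiff ℝ ∞ fun x : Plane => ∫ t, f (x i - t) * η (chart i (x (i + 1), t)) := by
  have hg : ContDiff ℝ ∞ fun q : Plane × ℝ => η (chart i (q.1 (i + 1), q.2)) :=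
    h.contDiff.comp ((chart i).contDiff.comp (by fun_prop))
  have hz : ∀ (x : Plane) (t : ℝ), x ∈ univ → t ∉ (fun x : Plane => x i) '' tsupport η →
      η (chart i (x (i + 1), t)) = 0 := fun x t _ ht =>
    image_eq_zero_of_notMem_tsupport fun hx => ht ⟨_, hx, by simp⟩
  have hconv := contDiffOn_convolution_right_with_param_comp (μ := volume)
    (ContinuousLinearMap.mul ℝ ℝ) (v := fun x : Plane => x i) (by fun_prop) isOpen_univ
    (h.hasCompactSupport.isCompact.image (by fun_prop)) hz hf hg.contDiffOn
  simpa only [convolution_eq_swap, contDiffOn_univ, ContinuousLinearMap.mul_apply'] using hconv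

theorem lineAverage (h : IsTest (box a b) η) (hβ : IsProfile (a i) (b i) β) :
    IsTest (box a b) (lineAverage i β η) := by
  have hsmooth : ContDiff ℝ ∞ (Plane.lineAverage i β η) := by
    refine ContDiff.mul ?_ (hβ.contDiff.comp (by fun_prop))
    simpa using h.contDiff_integral_comp_sub_mul i (locallyIntegrable_const 1)
  refine of_support_subset (((h.hasCompactSupport.isCompact.image
    (f := fun x : Plane => x (i + 1)) (by fun_prop)).prod
      hβ.hasCompactSupport.isCompact).image (chart i).continuous) ?_ hsmooth fun x hx => ?_
  · rintro _ ⟨p, ⟨⟨x, hx, hxp⟩, hp⟩, rfl⟩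
    exact chart_mem_box.2 ⟨hxp ▸ h.tsupport_subset hx (i + 1), hβ.tsupport_subset hp⟩
  · obtain ⟨t, ht⟩ : ∃ t, η (chart i (x (i + 1), t)) ≠ 0 := by
      by_contra! h0
      simp [Plane.lineAverage, h0] at hx
    refine ⟨(x (i + 1), x i), ⟨⟨_, subset_tsupport _ ht, by simp⟩, ?_⟩, chart_coords i x⟩
    exact subset_tsupport _ (right_ne_zero_of_mul hx)

theorem linePrimitive (h : IsTest (box a b) η) (i : Fin 2)
    (h0 : ∀ s, ∫ t, η (chart i (s, t)) = 0) : IsTest (box a b) (linePrimitive i η) := by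
  have hsmooth : ContDiff ℝ ∞ (Plane.linePrimitive i η) := by
    convert h.contDiff_integral_comp_sub_mul i (f := (Ici 0).indicator 1)
      ((locallyIntegrable_const 1).indicator measurableSet_Ici) using 2 with x
    rw [Plane.linePrimitive, ← integral_indicator measurableSet_Iic]
    simp [indicator_apply]
  obtain ⟨c, d, hcd, hsub⟩ := exists_Icc_of_isCompact_subset_Ioo
    (h.hasCompactSupport.isCompact.image (f := fun x : Plane => x i) (by fun_prop))
    (image_subset_iff.2 fun x hx => h.tsupport_subset hx i)
  have hz : ∀ s t, t ∉ Icc c d → η (chart i (s, t)) = 0 := fun s t ht =>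
    image_eq_zero_of_notMem_tsupport fun hx => ht (hcd ⟨_, hx, by simp⟩)
  refine of_support_subset (((h.hasCompactSupport.isCompact.image
    (f := fun x : Plane => x (i + 1)) (by fun_prop)).prod
      (isCompact_Icc (a := c) (b := d))).image (chart i).continuous) ?_ hsmooth fun x hx => ?_
  · rintro _ ⟨p, ⟨⟨x, hx, hxp⟩, hp⟩, rfl⟩
    exact chart_mem_box.2 ⟨hxp ▸ h.tsupport_subset hx (i + 1), hsub hp⟩
  · have hx' : ∫ τ in Iic (x i), η (chart i (x (i + 1), τ)) ≠ 0 := hx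
    obtain ⟨t, htx, ht⟩ : ∃ t ≤ x i, η (chart i (x (i + 1), t)) ≠ 0 := by
      by_contra! hall
      exact hx' (setIntegral_eq_zero_of_forall_eq_zero hall)
    have hxd : x i ≤ d := by
      by_contra! hd
      refine hx' ((setIntegral_eq_integral_of_forall_compl_eq_zero fun τ hτ => hz _ _ ?_).trans
        (h0 _))
      exact fun hτ' => hτ (hτ'.2.trans hd.le)
    have hct : t ∈ Icc c d := by_contra fun hn => ht (hz _ _ hn)
    exact ⟨(x (i + 1), x i), ⟨⟨_, subset_tsupport _ ht, by simp⟩, hct.1.trans htx, hxd⟩,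
      chart_coords i x⟩

theorem fderiv_linePrimitive (h : IsTest Ω η) (hd : Differentiable ℝ (Plane.linePrimitive i η))
    (x : Plane) : fderiv ℝ (Plane.linePrimitive i η) x (e i) = η x := by
  have h1 := hasDerivAt_comp_chart hd i (x (i + 1)) (x i)
  have hint := h.integrable_slice i (x (i + 1))
  have h2 : HasDerivAt (fun t => ∫ τ in Iic t, η (chart i (x (i + 1), τ)))
      (η (chart i (x (i + 1), x i))) (x i) := by
    have hc := (h.contDiff_slice i (x (i + 1))).continuous
    have heq : ∀ t, ∫ τ in Iic t, η (chart i (x (i + 1), τ)) =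
        (∫ τ in Iic 0, η (chart i (x (i + 1), τ))) + ∫ τ in 0..t, η (chart i (x (i + 1), τ)) :=
      fun t => by
        rw [← intervalIntegral.integral_Iic_sub_Iic hint.integrableOn hint.integrableOn,
          add_sub_cancel]
    rw [funext heq]
    exact (intervalIntegral.integral_hasDerivAt_right hint.intervalIntegrable
      (hc.stronglyMeasurableAtFilter _ _) hc.continuousAt).const_add _
  simp only [linePrimitive_chart] at h1
  simpa only [chart_coords] using h1.unique h2

theorem exists_fderiv_eq_sub_lineAverage (h : IsTest (box a b) η)
    (hβ : IsProfile (a i) (b i) β) :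
    ∃ E, IsTest (box a b) E ∧ ∀ x, fderiv ℝ E x (e i) = η x - Plane.lineAverage i β η x := by
  have hsub := h.sub (h.lineAverage hβ)
  have hE := hsub.linePrimitive i fun s => by
    simp only [lineAverage_chart]
    rw [integral_sub (h.integrable_slice i s) (hβ.integrable.const_mul _), integral_const_mul,
      hβ.integral_eq_one, mul_one, sub_self]
  exact ⟨_, hE, hsub.fderiv_linePrimitive hE.differentiable⟩

end IsTest

/-! ### Absolute continuity on lines -/

theorem absolutelyContinuousOnInterval_comp_lipschitzOnWith {X Y : Type*} [PseudoMetricSpace X]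
    [PseudoMetricSpace Y] {f : ℝ → X} {g : X → Y} {a b : ℝ} {K : ℝ≥0} {s : Set X}
    (hf : AbsolutelyContinuousOnInterval f a b) (hg : LipschitzOnWith K g s)
    (hs : MapsTo f (uIcc a b) s) : AbsolutelyContinuousOnInterval (fun t => g (f t)) a b := by
  rw [AbsolutelyContinuousOnInterval] at hf ⊢
  refine squeeze_zero' (Eventually.of_forall fun E => Finset.sum_nonneg fun _ _ => dist_nonneg) ?_
    (by simpa only [mul_zero] using hf.const_mul (K : ℝ))
  filter_upwards [mem_inf_of_right (mem_principal_self _)] with E hE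
  rw [Finset.mul_sum]
  exact Finset.sum_le_sum fun i hi => hg.dist_le_mul _ (hs (hE.1 i hi).1) _ (hs (hE.1 i hi).2)

theorem mapsTo_of_ae_mem {X : Type*} [TopologicalSpace X] {a b : ℝ} {F : ℝ → X} (hab : a < b)
    (hF : ContinuousOn F (uIcc a b)) {s : Set X} (hs : IsClosed s)
    (h : ∀ᵐ t ∂volume.restrict (Ioo a b), F t ∈ s) : MapsTo F (uIcc a b) s := by
  set D := Ioo a b ∩ {t | t ∈ Ioo a b → F t ∈ s}
  have hD : closure D = uIcc a b := by
    rw [uIcc_of_le hab.le, ← closure_Ioo hab.ne]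
    exact (closure_mono inter_subset_left).antisymm (closure_minimal
      ((Measure.dense_of_ae ((ae_restrict_iff' measurableSet_Ioo).1 h)).open_subset_closure_inter
        isOpen_Ioo) isClosed_closure)
  rw [← hD] at hF ⊢
  simpa only [hs.closure_eq] using
    MapsTo.closure_of_continuousOn (t := s) (fun t ht => ht.2 ht.1) hF

/-- On `(a, b)`, the function `F` agrees almost everywhere with a function that is absolutely
continuous on `[a, b]`, with derivative `G`. -/
def HasACRep {E : Type*} [NormedAddCommGroup E] [NormedSpace ℝ E] (a b : ℝ) (F G : ℝ → E) : Prop :=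
  ∃ F' : ℝ → E, AbsolutelyContinuousOnInterval F' a b ∧ F =ᵐ[volume.restrict (Ioo a b)] F' ∧
    ∀ᵐ t ∂volume.restrict (Ioo a b), HasDerivAt F' (G t) t

namespace HasACRep

variable {E : Type*} [NormedAddCommGroup E] [NormedSpace ℝ E] {a b : ℝ}

theorem congr {F G F₁ G₁ : ℝ → E} (h : HasACRep a b F G)
    (hF : F₁ =ᵐ[volume.restrict (Ioo a b)] F) (hG : G₁ =ᵐ[volume.restrict (Ioo a b)] G) :
    HasACRep a b F₁ G₁ := by
  obtain ⟨F', h1, h2, h3⟩ := h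
  refine ⟨F', h1, hF.trans h2, ?_⟩
  filter_upwards [h3, hG] with t ht ht'
  rwa [ht']

theorem const (a b : ℝ) (c : E) : HasACRep a b (fun _ => c) fun _ => 0 :=
  ⟨_, (LipschitzWith.const c).lipschitzOnWith.absolutelyContinuousOnInterval, ae_eq_rfl,
    Eventually.of_forall fun t => hasDerivAt_const t c⟩

theorem add {F G F₁ G₁ : ℝ → E} (h : HasACRep a b F G) (h₁ : HasACRep a b F₁ G₁) :
    HasACRep a b (fun t => F t + F₁ t) fun t => G t + G₁ t := by
  obtain ⟨F', h1, h2, h3⟩ := h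
  obtain ⟨F₁', k1, k2, k3⟩ := h₁
  refine ⟨_, h1.add k1, h2.add k2, ?_⟩
  filter_upwards [h3, k3] with t ht kt using ht.add kt

theorem mul {𝕜 : Type*} [RCLike 𝕜] {F G F₁ G₁ : ℝ → 𝕜} (h : HasACRep a b F G)
    (h₁ : HasACRep a b F₁ G₁) :
    HasACRep a b (fun t => F t * F₁ t) fun t => G t * F₁ t + F t * G₁ t := by
  obtain ⟨F', h1, h2, h3⟩ := h
  obtain ⟨F₁', k1, k2, k3⟩ := h₁
  refine ⟨_, h1.smul k1, h2.mul k2, ?_⟩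
  filter_upwards [h2, k2, h3, k3] with t ht2 kt2 ht kt
  rw [ht2, kt2]
  exact ht.mul kt

theorem clm_comp {E' : Type*} [NormedAddCommGroup E'] [NormedSpace ℝ E'] {F G : ℝ → E}
    (h : HasACRep a b F G) (L : E →L[ℝ] E') :
    HasACRep a b (fun t => L (F t)) fun t => L (G t) := by
  obtain ⟨F', h1, h2, h3⟩ := h
  refine ⟨_, absolutelyContinuousOnInterval_comp_lipschitzOnWith h1
    (L.lipschitz.lipschitzOnWith (s := univ)) (mapsTo_univ _ _), h2.fun_comp L, ?_⟩
  filter_upwards [h3] with t ht using L.hasFDerivAt.comp_hasDerivAt t ht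

theorem comp_of_lipschitzOnWith {E' : Type*} [NormedAddCommGroup E'] [NormedSpace ℝ E']
    {F G : ℝ → ℝ} (h : HasACRep a b F G) (hab : a < b) {Φ Φ' : ℝ → E'} {s : Set ℝ} {K : ℝ≥0}
    (hs : IsClosed s) (hF : MapsTo F (Ioo a b) s)
    (hΦ : LipschitzOnWith K Φ s) (hd : ∀ y ∈ s, HasDerivAt Φ (Φ' y) y) :
    HasACRep a b (fun t => Φ (F t)) fun t => G t • Φ' (F t) := by
  obtain ⟨F', h1, h2, h3⟩ := h
  have hF' : MapsTo F' (uIcc a b) s :=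
    mapsTo_of_ae_mem hab h1.continuousOn hs <| by
      filter_upwards [h2, ae_restrict_mem measurableSet_Ioo] with t ht hm using ht ▸ hF hm
  refine ⟨_, absolutelyContinuousOnInterval_comp_lipschitzOnWith h1 hΦ hF', h2.fun_comp Φ, ?_⟩
  filter_upwards [h2, h3, ae_restrict_mem measurableSet_Ioo] with t ht2 ht hm
  rw [ht2]
  exact (hd _ (ht2 ▸ hF hm)).scomp t ht

theorem integral_deriv_mul {F G ζ : ℝ → ℝ} (h : HasACRep a b F G) (hab : a ≤ b)
    (hζ : ContDiff ℝ 1 ζ) (ha : ζ a = 0) (hb : ζ b = 0) :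
    ∫ t in Ioo a b, deriv ζ t * F t = -∫ t in Ioo a b, ζ t * G t := by
  obtain ⟨F', h1, h2, h3⟩ := h
  have hparts := AbsolutelyContinuousOnInterval.integral_mul_deriv_eq_deriv_mul
    (hζ.contDiffOn (s := uIcc a b)).absolutelyContinuousOnInterval h1
  simp only [ha, hb, zero_mul, sub_zero, zero_sub, intervalIntegral.integral_of_le hab,
    integral_Ioc_eq_integral_Ioo] at hparts
  calc ∫ t in Ioo a b, deriv ζ t * F t = ∫ t in Ioo a b, deriv ζ t * F' t :=
        integral_congr_ae (h2.mono fun t ht => by simp only [ht])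
    _ = -∫ t in Ioo a b, ζ t * deriv F' t := by rw [hparts, neg_neg]
    _ = -∫ t in Ioo a b, ζ t * G t := by
        congr 1
        exact integral_congr_ae (h3.mono fun t ht => by simp only [ht.deriv])

theorem integral_Iic {h : ℝ → ℝ} (hh : Integrable h) (a b : ℝ) :
    HasACRep a b (fun t => ∫ τ in Iic t, h τ) h := by
  have hloc : IntervalIntegrable h volume a b := hh.intervalIntegrable
  refine ((const a b (∫ τ in Iic a, h τ)).add (F₁ := fun t => ∫ τ in a..t, h τ) (G₁ := h)
    ⟨_, hloc.absolutelyContinuousOnInterval_intervalIntegral left_mem_uIcc, ae_eq_rfl, ?_⟩).congr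
    ?_ ?_
  · filter_upwards [ae_restrict_of_ae hloc.ae_hasDerivAt_integral,
      ae_restrict_mem measurableSet_Ioo] with t ht hm
    exact ht (Icc_subset_uIcc (Ioo_subset_Icc_self hm)) a left_mem_uIcc
  · refine Eventually.of_forall fun t => ?_
    simp only
    rw [← intervalIntegral.integral_Iic_sub_Iic hh.integrableOn hh.integrableOn, add_sub_cancel]
  · exact Eventually.of_forall fun t => (zero_add _).symm

end HasACRep

namespace Plane

/-- `f` is absolutely continuous on almost every line in direction `i`, with derivative `g`,
within every closed rectangle contained in `Ω`. -/
def IsACL {E : Type*} [NormedAddCommGroup E] [NormedSpace ℝ E] (Ω : Set Plane) (i : Fin 2)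
    (f g : Plane → E) : Prop :=
  ∀ a b : Fin 2 → ℝ, (∀ k, a k < b k) → closedBox a b ⊆ Ω →
    ∀ᵐ s ∂volume.restrict (Ioo (a (i + 1)) (b (i + 1))),
      HasACRep (a i) (b i) (fun t => f (chart i (s, t))) fun t => g (chart i (s, t))

variable {a b : Fin 2 → ℝ} {i : Fin 2} {η : Plane → ℝ}

theorem integrable_lineMoment {W : Plane → ℝ} (hW : Integrable W) {l u : ℝ} {β : ℝ → ℝ}
    (hβ : IsProfile l u β) : Integrable (lineMoment i β W) := by
  obtain ⟨C, hC⟩ := hβ.hasCompactSupport.exists_bound_of_continuous hβ.contDiff.continuous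
  exact (((integrable_chart i).2 hW).bdd_mul (c := C) (f := fun p : ℝ × ℝ => β p.2)
    (hβ.contDiff.continuous.comp continuous_snd).aestronglyMeasurable
    (Eventually.of_forall fun p => hC p.2)).integral_prod_left

theorem integrableOn_lineMoment {W : Plane → ℝ} (hW : Integrable W) {l u : ℝ} {β : ℝ → ℝ}
    (hβ : IsProfile l u β) :
    IntegrableOn (fun x : Plane => lineMoment i β W (x (i + 1))) (box a b) :=
  integrableOn_comp_coord i (integrable_lineMoment hW hβ)

theorem integral_lineAverage_mul {W : Plane → ℝ} (hη : IsTest (box a b) η) (hW : Integrable W)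
    {β : ℝ → ℝ} (hβ : IsProfile (a i) (b i) β) :
    ∫ x, lineAverage i β η x * W x = ∫ x, η x * lineMoment i β W (x (i + 1)) := by
  have h1 := (hη.lineAverage hβ).integrable_smul (hW.locallyIntegrable.locallyIntegrableOn _)
  have h2 := hη.integrable_smul (integrableOn_lineMoment (i := i) hW hβ).locallyIntegrableOn
  simp only [smul_eq_mul] at h1 h2
  rw [integral_eq_integral_integral h1 i, integral_eq_integral_integral h2 i]
  refine integral_congr_ae (Eventually.of_forall fun s => ?_)
  simp only [lineAverage_chart, chart_apply_add_one, mul_assoc, integral_const_mul,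
    integral_mul_const, lineMoment]

theorem ae_eq_of_integral_fderiv_mul_eq_zero (hab : ∀ k, a k < b k) {D : Plane → ℝ}
    (hD : IntegrableOn D (box a b))
    (h : ∀ η, IsTest (box a b) η → ∫ x, fderiv ℝ η x (e i) * D x = 0) :
    ∃ w : ℝ → ℝ, ∀ᵐ x ∂volume.restrict (box a b), D x = w (x (i + 1)) := by
  obtain ⟨β, hβ⟩ := exists_isProfile (hab i)
  set W := (box a b).indicator D
  have hW : Integrable W := (integrable_indicator_iff isOpen_box.measurableSet).2 hD
  have hwi : IntegrableOn (fun x : Plane => lineMoment i β W (x (i + 1))) (box a b) :=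
    integrableOn_lineMoment hW hβ
  refine ⟨lineMoment i β W, (ae_restrict_iff' isOpen_box.measurableSet).2 ?_⟩
  refine (isOpen_box.ae_eq_zero_of_integral_contDiff_smul_eq_zero
    (hD.sub hwi).locallyIntegrableOn fun η h1 h2 h3 => ?_).mono fun x hx hm => sub_eq_zero.1 (hx hm)
  have hη : IsTest (box a b) η := ⟨h1, h2, h3⟩
  have hA := hη.lineAverage hβ
  obtain ⟨E, hE, hEη⟩ := hη.exists_fderiv_eq_sub_lineAverage hβ
  have i1 := hη.integrable_smul hD.locallyIntegrableOn
  have i2 := hA.integrable_smul hD.locallyIntegrableOn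
  have i3 := hη.integrable_smul hwi.locallyIntegrableOn
  simp only [smul_eq_mul] at i1 i2 i3
  calc ∫ x, η x • (D x - lineMoment i β W (x (i + 1)))
      = (∫ x, η x * D x) - ∫ x, lineAverage i β η x * D x := by
        simp only [smul_eq_mul, mul_sub]
        rw [integral_sub i1 i3, ← integral_lineAverage_mul hη hW hβ]
        simp only [W, hA.mul_indicator]
    _ = ∫ x, fderiv ℝ E x (e i) * D x := by simp only [hEη, sub_mul, integral_sub i1 i2]
    _ = 0 := h E hE

theorem integral_fderiv_mul_of_hasACRep (hη : IsTest (box a b) η) (hab : ∀ k, a k < b k)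
    {f g : Plane → ℝ} (hf : IntegrableOn f (box a b)) (hg : IntegrableOn g (box a b))
    (h : ∀ᵐ s ∂volume.restrict (Ioo (a (i + 1)) (b (i + 1))),
      HasACRep (a i) (b i) (fun t => f (chart i (s, t))) fun t => g (chart i (s, t))) :
    ∫ x, fderiv ℝ η x (e i) * f x = -∫ x, η x * g x := by
  have hη' := hη.fderiv_apply (e i)
  have h1 := hη'.integrable_smul hf.locallyIntegrableOn
  have h2 := hη.integrable_smul hg.locallyIntegrableOn
  simp only [smul_eq_mul] at h1 h2
  rw [← hη'.setIntegral_mul, ← hη.setIntegral_mul, setIntegral_box i h1.integrableOn,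
    setIntegral_box i h2.integrableOn, ← integral_neg]
  have hz : ∀ s t, t ∉ Ioo (a i) (b i) → η (chart i (s, t)) = 0 := fun s t ht =>
    hη.eq_zero_of_notMem fun hm => ht (chart_mem_box.1 hm).2
  refine integral_congr_ae (h.mono fun s hs => ?_)
  simpa only [hη.deriv_slice] using hs.integral_deriv_mul (hab i).le
    ((hη.contDiff_slice i s).of_le (by simp)) (hz _ _ (by simp)) (hz _ _ (by simp))

theorem ae_hasACRep_linePrimitive {g : Plane → ℝ} (hg : Integrable g) (i : Fin 2) (l u : ℝ) :
    ∀ᵐ s, HasACRep l u (fun t => linePrimitive i g (chart i (s, t))) fun t => g (chart i (s, t)) :=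
  (ae_integrable_slice hg i).mono fun s hs => by
    simpa only [linePrimitive_chart] using HasACRep.integral_Iic hs l u

theorem integrableOn_box_of_closedBox_subset {F : Type*} [NormedAddCommGroup F] {Ω : Set Plane}
    {f : Plane → F} (hf : LocallyIntegrableOn f Ω) (hQ : closedBox a b ⊆ Ω) :
    IntegrableOn f (box a b) :=
  (hf.integrableOn_compact_subset hQ isCompact_closedBox).mono_set box_subset_closedBox

end Plane

namespace HasWeakPartial

open Plane

variable {Ω : Set Plane} {i : Fin 2} {a b : Fin 2 → ℝ}

theorem isACL_real {f g : Plane → ℝ} (h : HasWeakPartial Ω i f g) : IsACL Ω i f g := by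
  intro a b hab hQ
  have hfi := integrableOn_box_of_closedBox_subset h.locallyIntegrableOn hQ
  have hgi := integrableOn_box_of_closedBox_subset h.locallyIntegrableOn_deriv hQ
  set G := (box a b).indicator g
  have hG : Integrable G := (integrable_indicator_iff isOpen_box.measurableSet).2 hgi
  set u := linePrimitive i G
  have hu : IntegrableOn u (box a b) := integrableOn_linePrimitive i hG
  have hD : ∀ η, IsTest (box a b) η → ∫ x, fderiv ℝ η x (e i) * (f x - u x) = 0 := fun η hη => by
    have i1 := (hη.fderiv_apply (e i)).integrable_smul hfi.locallyIntegrableOn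
    have i2 := (hη.fderiv_apply (e i)).integrable_smul hu.locallyIntegrableOn
    have hηΩ := hη.mono (box_subset_closedBox.trans hQ)
    have hf := h.integral_eq η hηΩ.contDiff hηΩ.hasCompactSupport hηΩ.tsupport_subset
    simp only [smul_eq_mul] at i1 i2 hf
    simp only [mul_sub]
    rw [integral_sub i1 i2, hf, integral_fderiv_mul_of_hasACRep hη hab hu hG.integrableOn
      (ae_restrict_of_ae (ae_hasACRep_linePrimitive hG i _ _))]
    simp only [G, hη.mul_indicator, sub_self]
  obtain ⟨w, hw⟩ := ae_eq_of_integral_fderiv_mul_eq_zero hab (hfi.sub hu) hD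
  have hgG : ∀ᵐ x ∂volume.restrict (box a b), g x = G x :=
    (indicator_ae_eq_restrict isOpen_box.measurableSet).symm
  filter_upwards [ae_restrict_box_chart hw i, ae_restrict_box_chart hgG i,
    ae_restrict_of_ae (ae_hasACRep_linePrimitive hG i (a i) (b i))] with s hf hg hs
  refine ((HasACRep.const _ _ (w s)).add hs).congr ?_ ?_
  · filter_upwards [hf] with t ht
    simp only [Pi.sub_apply, chart_apply_add_one] at ht
    linarith
  · filter_upwards [hg] with t ht
    rw [ht, zero_add]

end HasWeakPartial

/-! ### Calculus of weak derivatives -/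

namespace IsTest

variable {Ω : Set Plane} {η ζ : Plane → ℝ}

theorem add (h : IsTest Ω η) (hζ : IsTest Ω ζ) : IsTest Ω (η + ζ) :=
  of_support_subset (h.hasCompactSupport.isCompact.union hζ.hasCompactSupport.isCompact)
    (union_subset h.tsupport_subset hζ.tsupport_subset) (h.contDiff.add hζ.contDiff)
    ((Function.support_add η ζ).trans (union_subset_union subset_closure subset_closure))

open scoped Manifold in
theorem exists_sum_eq {ι : Type*} {U : ι → Set Plane} (hη : IsTest Ω η) (hU : ∀ k, IsOpen (U k))
    (hΩ : Ω ⊆ ⋃ k, U k) :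
    ∃ (t : Finset ι) (ζ : t → Plane → ℝ),
      (∀ k : t, IsTest (Ω ∩ U k) (ζ k)) ∧ ∑ k, ζ k = η := by
  obtain ⟨t, ht⟩ := hη.hasCompactSupport.isCompact.elim_finite_subcover U hU
    (hη.tsupport_subset.trans hΩ)
  obtain ⟨p, hp⟩ := SmoothPartitionOfUnity.exists_isSubordinate 𝓘(ℝ, Plane)
    (isClosed_tsupport η) (fun k : t => U k) (fun k => hU k) (by simpa [iUnion_subtype] using ht)
  refine ⟨t, fun k x => p k x * η x, fun k => ?_, ?_⟩
  · have h := hη.mul_left (p k).contMDiff.contDiff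
    exact ⟨h.contDiff, h.hasCompactSupport, subset_inter h.tsupport_subset
      ((closure_mono (Function.support_mul_subset_left (p k) η)).trans (hp k))⟩
  · ext x
    rw [Finset.sum_apply, ← Finset.sum_mul]
    by_cases hx : x ∈ tsupport η
    · rw [← finsum_eq_sum_of_fintype, p.sum_eq_one hx, one_mul]
    · rw [image_eq_zero_of_notMem_tsupport hx, mul_zero]

theorem induction_on_cover {P : (Plane → ℝ) → Prop} (hη : IsTest Ω η)
    (cover : ∀ x ∈ Ω, ∃ U, IsOpen U ∧ x ∈ U ∧ ∀ ζ, IsTest U ζ → P ζ) (zero : P 0)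
    (add : ∀ ζ₁ ζ₂, IsTest Ω ζ₁ → IsTest Ω ζ₂ → P ζ₁ → P ζ₂ → P (ζ₁ + ζ₂)) : P η := by
  choose U hU hxU hP using cover
  obtain ⟨t, ζ, hζ, rfl⟩ := hη.exists_sum_eq (U := fun x : Ω => U x x.2) (fun x => hU x x.2)
    fun x hx => mem_iUnion.2 ⟨⟨x, hx⟩, hxU x hx⟩
  have h0 : IsTest Ω 0 := ⟨contDiff_const, HasCompactSupport.zero, by simp⟩
  refine (Finset.induction_on (motive := fun s => IsTest Ω (∑ k ∈ s, ζ k) ∧ P (∑ k ∈ s, ζ k))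
    Finset.univ ⟨by simpa using h0, by simpa using zero⟩ fun k s hk ih => ?_).2
  have hk' := (hζ k).mono inter_subset_left
  rw [Finset.sum_insert hk]
  exact ⟨hk'.add ih.1, add _ _ hk' ih.1 (hP _ _ _ ((hζ k).mono inter_subset_right)) ih.2⟩

theorem fderiv_add_apply (h : IsTest Ω η) (hζ : IsTest Ω ζ) (x v : Plane) :
    fderiv ℝ (η + ζ) x v = fderiv ℝ η x v + fderiv ℝ ζ x v := by
  rw [fderiv_add (h.differentiable x) (hζ.differentiable x), add_apply]

end IsTest

theorem locallyIntegrableOn_clm_comp {E E' : Type*} [NormedAddCommGroup E] [NormedSpace ℝ E]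
    [NormedAddCommGroup E'] [NormedSpace ℝ E'] {Ω : Set Plane} {f : Plane → E}
    (hf : LocallyIntegrableOn f Ω) (L : E →L[ℝ] E') :
    LocallyIntegrableOn (fun x => L (f x)) Ω := fun x hx => by
  obtain ⟨s, hs, h⟩ := hf x hx
  exact ⟨s, hs, L.integrable_comp h⟩

namespace HasWeakPartial

open Plane

variable {𝕜 𝕜' : Type*} [RCLike 𝕜] [RCLike 𝕜'] {Ω : Set Plane} {i : Fin 2} {f g f₁ g₁ : Plane → 𝕜}

theorem mono {Ω' : Set Plane} (h : HasWeakPartial Ω' i f g) (hΩ : Ω ⊆ Ω') :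
    HasWeakPartial Ω i f g :=
  ⟨h.1.mono_set hΩ, h.2.mono_set hΩ, fun η h1 h2 h3 => h.3 η h1 h2 (h3.trans hΩ)⟩

theorem aestronglyMeasurable_deriv {V : Set Plane} (h : HasWeakPartial Vᶜ i f g)
    (hV : ∀ᵐ x, x ∉ V) : AEStronglyMeasurable g := by
  have hVc : volume.restrict Vᶜ = volume := Measure.restrict_eq_self_of_ae_mem hV
  exact hVc ▸ h.locallyIntegrableOn_deriv.aestronglyMeasurable

theorem of_locally (hf : LocallyIntegrableOn f Ω) (hg : LocallyIntegrableOn g Ω)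
    (h : ∀ x ∈ Ω, ∃ U, IsOpen U ∧ x ∈ U ∧ ∀ η, IsTest U η →
      ∫ x, fderiv ℝ η x (e i) • f x = -∫ x, η x • g x) : HasWeakPartial Ω i f g := by
  refine ⟨hf, hg, fun η h1 h2 h3 => ?_⟩
  refine IsTest.induction_on_cover ⟨h1, h2, h3⟩ h (by simp) fun ζ₁ ζ₂ hζ₁ hζ₂ e₁ e₂ => ?_
  simp only [hζ₁.fderiv_add_apply hζ₂, Pi.add_apply, add_smul]
  rw [integral_add ((hζ₁.fderiv_apply _).integrable_smul hf)
    ((hζ₂.fderiv_apply _).integrable_smul hf),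
    integral_add (hζ₁.integrable_smul hg) (hζ₂.integrable_smul hg), e₁, e₂, neg_add]

theorem integral_fderiv_smul {η : Plane → ℝ} (h : HasWeakPartial Ω i f g) (hη : IsTest Ω η) :
    ∫ x, fderiv ℝ η x (e i) • f x = -∫ x, η x • g x :=
  h.integral_eq η hη.contDiff hη.hasCompactSupport hη.tsupport_subset

theorem clm_comp (h : HasWeakPartial Ω i f g) (L : 𝕜 →L[ℝ] 𝕜') :
    HasWeakPartial Ω i (fun x => L (f x)) fun x => L (g x) := by
  refine ⟨locallyIntegrableOn_clm_comp h.1 L, locallyIntegrableOn_clm_comp h.2 L,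
    fun η h1 h2 h3 => ?_⟩
  have hη : IsTest Ω η := ⟨h1, h2, h3⟩
  simp only [← map_smul]
  rw [L.integral_comp_comm ((hη.fderiv_apply _).integrable_smul h.1),
    L.integral_comp_comm (hη.integrable_smul h.2), h.integral_fderiv_smul hη, map_neg]

theorem add (h : HasWeakPartial Ω i f g) (h₁ : HasWeakPartial Ω i f₁ g₁) :
    HasWeakPartial Ω i (fun x => f x + f₁ x) fun x => g x + g₁ x := by
  refine ⟨h.1.add h₁.1, h.2.add h₁.2, fun η k1 k2 k3 => ?_⟩
  have hη : IsTest Ω η := ⟨k1, k2, k3⟩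
  simp only [smul_add]
  rw [integral_add ((hη.fderiv_apply _).integrable_smul h.1)
    ((hη.fderiv_apply _).integrable_smul h₁.1), integral_add (hη.integrable_smul h.2)
    (hη.integrable_smul h₁.2), h.integral_fderiv_smul hη, h₁.integral_fderiv_smul hη, neg_add]

end HasWeakPartial

namespace Plane

variable {𝕜 : Type*} [RCLike 𝕜] {Ω : Set Plane} {i : Fin 2}

theorem isACL_iff_re_im {f g : Plane → 𝕜} : IsACL Ω i f g ↔
    IsACL Ω i (fun x => RCLike.re (f x)) (fun x => RCLike.re (g x)) ∧
      IsACL Ω i (fun x => RCLike.im (f x)) fun x => RCLike.im (g x) := by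
  refine ⟨fun h => ⟨fun a b hab hQ => ?_, fun a b hab hQ => ?_⟩, fun h a b hab hQ => ?_⟩
  · filter_upwards [h a b hab hQ] with s hs using hs.clm_comp RCLike.reCLM
  · filter_upwards [h a b hab hQ] with s hs using hs.clm_comp RCLike.imCLM
  · filter_upwards [h.1 a b hab hQ, h.2 a b hab hQ] with s hre him
    simpa [RCLike.re_add_im, RCLike.real_smul_eq_coe_mul] using (hre.clm_comp RCLike.ofRealCLM).add
      (him.clm_comp (ContinuousLinearMap.toSpanSingleton ℝ (RCLike.I : 𝕜)))

end Plane

namespace HasWeakPartial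

open Plane

variable {𝕜 : Type*} [RCLike 𝕜] {Ω : Set Plane} {i : Fin 2} {f g f₁ g₁ : Plane → 𝕜}

theorem iff_re_im : HasWeakPartial Ω i f g ↔
    HasWeakPartial Ω i (fun x => RCLike.re (f x)) (fun x => RCLike.re (g x)) ∧
      HasWeakPartial Ω i (fun x => RCLike.im (f x)) fun x => RCLike.im (g x) := by
  refine ⟨fun h => ⟨h.clm_comp RCLike.reCLM, h.clm_comp RCLike.imCLM⟩, fun h => ?_⟩
  simpa [RCLike.re_add_im, RCLike.real_smul_eq_coe_mul] using (h.1.clm_comp RCLike.ofRealCLM).add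
    (h.2.clm_comp (ContinuousLinearMap.toSpanSingleton ℝ (RCLike.I : 𝕜)))

theorem of_isACL_real {f g : Plane → ℝ} (hΩ : IsOpen Ω) (hf : LocallyIntegrableOn f Ω)
    (hg : LocallyIntegrableOn g Ω) (h : IsACL Ω i f g) : HasWeakPartial Ω i f g := by
  refine of_locally hf hg fun x hx => ?_
  obtain ⟨a, b, hxb, hsub⟩ := exists_mem_box_of_mem_isOpen hΩ hx
  have hab : ∀ k, a k < b k := fun k => (hxb k).1.trans (hxb k).2
  exact ⟨box a b, isOpen_box, hxb, fun η hη => integral_fderiv_mul_of_hasACRep hη hab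
    (integrableOn_box_of_closedBox_subset hf hsub) (integrableOn_box_of_closedBox_subset hg hsub)
    (h a b hab hsub)⟩

theorem iff_isACL (hΩ : IsOpen Ω) : HasWeakPartial Ω i f g ↔
    LocallyIntegrableOn f Ω ∧ LocallyIntegrableOn g Ω ∧ IsACL Ω i f g := by
  refine ⟨fun h => ⟨h.1, h.2, isACL_iff_re_im.2 ?_⟩, fun ⟨hf, hg, h⟩ => iff_re_im.2 ?_⟩
  · exact (iff_re_im.1 h).imp isACL_real isACL_real
  · exact (isACL_iff_re_im.1 h).imp
      (of_isACL_real hΩ (locallyIntegrableOn_clm_comp hf RCLike.reCLM)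
        (locallyIntegrableOn_clm_comp hg RCLike.reCLM))
      (of_isACL_real hΩ (locallyIntegrableOn_clm_comp hf RCLike.imCLM)
        (locallyIntegrableOn_clm_comp hg RCLike.imCLM))

theorem mul (hΩ : IsOpen Ω) (h : HasWeakPartial Ω i f g) (h₁ : HasWeakPartial Ω i f₁ g₁)
    (hf : LocallyIntegrableOn (fun x => f x * f₁ x) Ω)
    (hg : LocallyIntegrableOn (fun x => g x * f₁ x + f x * g₁ x) Ω) :
    HasWeakPartial Ω i (fun x => f x * f₁ x) fun x => g x * f₁ x + f x * g₁ x := by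
  refine (iff_isACL hΩ).2 ⟨hf, hg, fun a b hab hQ => ?_⟩
  filter_upwards [((iff_isACL hΩ).1 h).2.2 a b hab hQ, ((iff_isACL hΩ).1 h₁).2.2 a b hab hQ] with
    s hs hs₁ using hs.mul hs₁

theorem comp_of_lipschitzOnWith {u v : Plane → ℝ} (hΩ : IsOpen Ω) (h : HasWeakPartial Ω i u v)
    {Φ Φ' : ℝ → 𝕜} (hf : LocallyIntegrableOn (fun x => Φ (u x)) Ω)
    (hg : LocallyIntegrableOn (fun x => v x • Φ' (u x)) Ω)
    (hΦ : ∀ Q, IsCompact Q → Q ⊆ Ω → ∃ s K, IsClosed s ∧ MapsTo u Q s ∧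
      LipschitzOnWith K Φ s ∧ ∀ y ∈ s, HasDerivAt Φ (Φ' y) y) :
    HasWeakPartial Ω i (fun x => Φ (u x)) fun x => v x • Φ' (u x) := by
  refine (iff_isACL hΩ).2 ⟨hf, hg, fun a b hab hQ => ?_⟩
  obtain ⟨S, K, hS, hu, hLip, hd⟩ := hΦ _ isCompact_closedBox hQ
  filter_upwards [((iff_isACL hΩ).1 h).2.2 a b hab hQ, ae_restrict_mem measurableSet_Ioo] with
    s hs hsI
  exact hs.comp_of_lipschitzOnWith (hab i) hS
    (fun t ht => hu (box_subset_closedBox (chart_mem_box.2 ⟨hsI, ht⟩))) hLip hd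

end HasWeakPartial

namespace Plane

variable {E : Type*} [NormedAddCommGroup E] [NormedSpace ℝ E] {V : Set Plane} {i : Fin 2}
  {f g : Plane → E}

/-- Almost every line misses a locally finite set. -/
theorem IsACL.of_compl (hV : ∀ K, IsCompact K → (V ∩ K).Finite) (h : IsACL Vᶜ i f g) :
    IsACL univ i f g := by
  intro a b hab _
  set A := (fun x : Plane => x (i + 1)) '' (V ∩ closedBox a b)
  have hA : A.Finite := (hV _ isCompact_closedBox).image _
  set P := fun s => HasACRep (a i) (b i) (fun t => f (chart i (s, t))) fun t => g (chart i (s, t))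
  suffices hnull : volume {s | s ∈ Ioo (a (i + 1)) (b (i + 1)) \ A ∧ ¬P s} = 0 by
    rw [ae_restrict_iff' measurableSet_Ioo]
    filter_upwards [hA.countable.ae_notMem volume, measure_eq_zero_iff_ae_notMem.1 hnull] with
      s hsA hs hsI
    exact by_contra fun hP => hs ⟨⟨hsI, hsA⟩, hP⟩
  refine measure_null_of_locally_null _ fun s ⟨hs, _⟩ => ?_
  obtain ⟨l, u, hlu, hnhds, hsub⟩ : ∃ l u, s ∈ Ioo l u ∧ Ioo l u ∈ 𝓝 s ∧
      Icc l u ⊆ Ioo (a (i + 1)) (b (i + 1)) \ A := by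
    obtain ⟨ε, hε, hsub⟩ := Metric.nhds_basis_closedBall.mem_iff.1
      ((isOpen_Ioo.sdiff hA.isClosed).mem_nhds hs)
    rw [Real.closedBall_eq_Icc] at hsub
    exact ⟨s - ε, s + ε, by simpa, Ioo_mem_nhds (by linarith) (by linarith), hsub⟩
  have hP := h (chart i (l, a i)) (chart i (u, b i))
    ((forall_iff i).2 (by simpa using ⟨hlu.1.trans hlu.2, hab i⟩)) fun x hx hxV => by
      have h1 : x (i + 1) ∈ Icc l u := by simpa using hx (i + 1)
      have h2 : x i ∈ Icc (a i) (b i) := by simpa using hx i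
      exact (hsub h1).2 ⟨x, ⟨hxV, (forall_iff i).2 ⟨Ioo_subset_Icc_self (hsub h1).1, h2⟩⟩, rfl⟩
  simp only [chart_apply_add_one, chart_apply_self, ae_restrict_iff' measurableSet_Ioo] at hP
  refine ⟨_, inter_mem_nhdsWithin _ hnhds, measure_mono_null ?_ hP⟩
  exact fun t ht hP' => ht.1.2 (hP' ht.2)

end Plane

theorem HasWeakPartial.of_compl {𝕜 : Type*} [RCLike 𝕜] {V : Set Plane} {i : Fin 2}
    {f g : Plane → 𝕜} (hV : ∀ K, IsCompact K → (V ∩ K).Finite) (hVc : IsClosed V)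
    (h : HasWeakPartial Vᶜ i f g) (hf : LocallyIntegrable f) (hg : LocallyIntegrable g) :
    HasWeakPartial univ i f g :=
  (iff_isACL isOpen_univ).2 ⟨hf.locallyIntegrableOn _, hg.locallyIntegrableOn _,
    ((iff_isACL hVc.isOpen_compl).1 h).2.2.of_compl hV⟩

/-! ### Potentials of curl-free distributions -/

open scoped Distributions LineDeriv

namespace Plane

theorem chart_comm (i : Fin 2) (s t : ℝ) : chart (i + 1) (t, s) = chart i (s, t) := by
  ext k
  obtain rfl | rfl := eq_or_eq_add_one i k <;> simp [chart_apply, (add_one_ne _).symm]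

end Plane

namespace IsTest

open Plane

variable {Ω : Set Plane} {η ζ : Plane → ℝ} {i : Fin 2}

theorem fderiv_fderiv_comm (h : IsTest Ω η) (v w x : Plane) :
    fderiv ℝ (fun y => fderiv ℝ η y v) x w = fderiv ℝ (fun y => fderiv ℝ η y w) x v := by
  have hd : DifferentiableAt ℝ (fderiv ℝ η) x :=
    (h.contDiff.fderiv_right (m := ∞) (by simp)).differentiable (by simp) x
  have hsymm : IsSymmSndFDerivAt ℝ η x :=
    h.contDiff.contDiffAt.isSymmSndFDerivAt (n := ∞) (by
      simpa using WithTop.coe_le_coe.2 (le_top : (2 : ℕ∞) ≤ ⊤))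
  simpa [fderiv_clm_apply hd (differentiableAt_const _)] using hsymm.eq w v

theorem integral_Iic_fderiv (h : IsTest Ω η) (i : Fin 2) (s t : ℝ) :
    ∫ τ in Iic t, fderiv ℝ η (chart i (s, τ)) (e i) = η (chart i (s, t)) := by
  simp only [← h.deriv_slice]
  exact (h.hasCompactSupport_slice i s).integral_Iic_deriv_eq
    ((h.contDiff_slice i s).of_le (by exact_mod_cast le_top)) t

theorem integral_fderiv_slice (h : IsTest Ω η) (i : Fin 2) (s : ℝ) :
    ∫ τ, fderiv ℝ η (chart i (s, τ)) (e i) = 0 := by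
  simp only [← h.deriv_slice]
  refine integral_eq_zero_of_hasDerivAt_of_integrable
    (fun t => ((h.contDiff_slice i s).differentiable (by simp) t).hasDerivAt) ?_
    (h.integrable_slice i s)
  simpa only [← h.deriv_slice] using (h.fderiv_apply (e i)).integrable_slice i s

theorem eq_zero_of_fderiv_eq_zero (h : IsTest Ω η) (h0 : ∀ x, fderiv ℝ η x (e i) = 0) : η = 0 := by
  ext x
  rw [← chart_coords i x, ← h.integral_Iic_fderiv]
  simp [h0]

theorem integral_slice_eq_zero (hη : IsTest Ω η) (hζ : IsTest Ω ζ)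
    (h : ∀ x, fderiv ℝ η x (e (i + 1)) + fderiv ℝ ζ x (e i) = 0) (s : ℝ) :
    ∫ t, η (chart i (s, t)) = 0 := by
  have hint : Integrable fun p : ℝ × ℝ => fderiv ℝ η (chart i p) (e (i + 1)) :=
    (integrable_chart i).2 (hη.fderiv_apply _).integrable
  calc ∫ t, η (chart i (s, t))
      = ∫ t, ∫ σ in Iic s, fderiv ℝ η (chart i (σ, t)) (e (i + 1)) := by
        simp only [← chart_comm i, hη.integral_Iic_fderiv]
    _ = ∫ σ in Iic s, ∫ t, fderiv ℝ η (chart i (σ, t)) (e (i + 1)) :=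
        (integral_integral_swap (f := fun σ t => fderiv ℝ η (chart i (σ, t)) (e (i + 1))) <| by
          simpa [← Measure.prod_restrict, Measure.volume_eq_prod, Function.uncurry_def] using
            hint.restrict (s := Iic s ×ˢ univ)).symm
    _ = 0 := by
        simp only [eq_neg_of_add_eq_zero_left (h _), integral_neg, hζ.integral_fderiv_slice,
          neg_zero, integral_zero]

theorem exists_stream (hη : IsTest univ η) (hζ : IsTest univ ζ)
    (h : ∀ x, fderiv ℝ η x (e 0) + fderiv ℝ ζ x (e 1) = 0) :
    ∃ E, IsTest univ E ∧ (∀ x, fderiv ℝ E x (e 1) = η x) ∧ ∀ x, fderiv ℝ E x (e 0) = -ζ x := by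
  obtain ⟨M, hM, hsub⟩ := exists_subset_box hη.hasCompactSupport.isCompact
  obtain ⟨β, hβ⟩ := exists_isProfile (neg_lt_self hM)
  obtain ⟨E, hE, hE1⟩ := exists_fderiv_eq_sub_lineAverage (i := 1)
    ⟨hη.contDiff, hη.hasCompactSupport, hsub⟩ hβ
  have hE' : IsTest univ E := hE.mono (subset_univ _)
  simp only [Plane.lineAverage, hη.integral_slice_eq_zero (i := 1) hζ h, zero_mul, sub_zero] at hE1
  have hsum : IsTest univ ((fun x => fderiv ℝ E x (e 0)) + ζ) := (hE'.fderiv_apply _).add hζ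
  refine ⟨E, hE', hE1, fun x => eq_neg_of_add_eq_zero_left ?_⟩
  refine congrFun (hsum.eq_zero_of_fderiv_eq_zero (i := 1) fun y => ?_) x
  rw [(hE'.fderiv_apply _).fderiv_add_apply hζ, hE'.fderiv_fderiv_comm, ← h y, ← funext hE1]

end IsTest

/-- The space `𝓓(ℝ²)` of real test functions on the whole plane. -/
abbrev PlaneTest : Type := 𝓓((⊤ : TopologicalSpace.Opens Plane), ℝ)

namespace PlaneTest

theorem isTest (ζ : PlaneTest) : IsTest univ ζ :=
  ⟨ζ.contDiff, ζ.hasCompactSupport, subset_univ _⟩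

theorem lineDerivOp_apply (ζ : PlaneTest) (m x : Plane) : (∂_{m} ζ) x = fderiv ℝ ζ x m := by
  rw [TestFunction.lineDerivOp_eq_lineDerivCLM ℝ, TestFunction.lineDerivCLM_apply,
    if_pos (by simp), (ζ.isTest.differentiable x).lineDeriv_eq_fderiv]

end PlaneTest

/-- A test function in the predicate form `IsTest`, as an element of `𝓓(ℝ²)`. -/
def IsTest.toPlaneTest {Ω : Set Plane} {η : Plane → ℝ} (h : IsTest Ω η) : PlaneTest :=
  ⟨η, h.contDiff, h.hasCompactSupport, fun _ _ => trivial⟩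

@[simp]
theorem IsTest.coe_toPlaneTest {Ω : Set Plane} {η : Plane → ℝ} (h : IsTest Ω η) :
    ⇑h.toPlaneTest = η := rfl

open Plane in
/-- A functional with prescribed gradient is defined on all divergences, consistently because of
`IsTest.exists_stream`, and extends by linear algebra. -/
theorem PlaneTest.exists_potential (v : Fin 2 → PlaneTest →ₗ[ℝ] ℝ)
    (hv : ∀ ζ : PlaneTest, v 0 (∂_{e 1} ζ) = v 1 (∂_{e 0} ζ)) :
    ∃ T : PlaneTest →ₗ[ℝ] ℝ, ∀ i ζ, T (∂_{e i} ζ) = -v i ζ := by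
  let D (i : Fin 2) : PlaneTest →ₗ[ℝ] PlaneTest := (TestFunction.lineDerivCLM ℝ (e i)).toLinearMap
  have hD : ∀ i ζ, D i ζ = ∂_{e i} ζ := fun _ _ => rfl
  have hker : -(v 0).coprod (v 1) ∈ (LinearMap.ker ((D 0).coprod (D 1))).dualAnnihilator := by
    rw [Submodule.mem_dualAnnihilator]
    rintro ⟨p, q⟩ hpq
    have hdiv : ∀ x, fderiv ℝ p x (e 0) + fderiv ℝ q x (e 1) = 0 := fun x => by
      rw [← p.lineDerivOp_apply, ← q.lineDerivOp_apply]
      exact congrArg (fun ζ : PlaneTest => ζ x) (LinearMap.mem_ker.1 hpq)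
    obtain ⟨E, hE, h1, h0⟩ := p.isTest.exists_stream q.isTest hdiv
    have e1 : ∂_{e 1} hE.toPlaneTest = p := TestFunction.ext fun x => by
      rw [PlaneTest.lineDerivOp_apply, hE.coe_toPlaneTest, h1]
    have e0 : ∂_{e 0} hE.toPlaneTest = -q := TestFunction.ext fun x => by
      rw [PlaneTest.lineDerivOp_apply, hE.coe_toPlaneTest, h0]
      rfl
    have hpq' := hv hE.toPlaneTest
    rw [e1, e0, map_neg] at hpq'
    simp [hpq']
  rw [← LinearMap.range_dualMap_eq_dualAnnihilator_ker] at hker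
  obtain ⟨T, hT⟩ := hker
  have hT' : ∀ p q, T (D 0 p + D 1 q) = -(v 0 p + v 1 q) := fun p q => LinearMap.congr_fun hT (p, q)
  refine ⟨T, Fin.forall_fin_two.2 ⟨fun ζ => ?_, fun ζ => ?_⟩⟩
  · simpa [hD] using hT' ζ 0
  · simpa [hD] using hT' 0 ζ

namespace Plane

variable {a b : Fin 2 → ℝ}

theorem isTest_mul_of_isProfile {β₀ β₁ : ℝ → ℝ} (h₀ : IsProfile (a 0) (b 0) β₀)
    (h₁ : IsProfile (a 1) (b 1) β₁) : IsTest (box a b) fun x => β₀ (x 0) * β₁ (x 1) := by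
  refine IsTest.of_support_subset (K := chart 1 '' (tsupport β₀ ×ˢ tsupport β₁))
    ((h₀.hasCompactSupport.isCompact.prod h₁.hasCompactSupport.isCompact).image
      (chart 1).continuous) ?_
    ((h₀.contDiff.comp (by fun_prop)).mul (h₁.contDiff.comp (by fun_prop))) fun x hx => ?_
  · rintro _ ⟨p, hp, rfl⟩
    exact chart_mem_box.2 ⟨h₀.tsupport_subset hp.1, h₁.tsupport_subset hp.2⟩
  · exact ⟨(x 0, x 1), ⟨subset_tsupport _ (left_ne_zero_of_mul hx),
      subset_tsupport _ (right_ne_zero_of_mul hx)⟩, chart_coords 1 x⟩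

theorem lineAverage_lineAverage {η : Plane → ℝ} (hη : Integrable η) (β₀ β₁ : ℝ → ℝ) (x : Plane) :
    lineAverage 1 β₁ (lineAverage 0 β₀ η) x = (∫ y, η y) * (β₀ (x 0) * β₁ (x 1)) := by
  have h : ∀ t, lineAverage 0 β₀ η (chart 1 (x 0, t)) = (∫ τ, η (chart 0 (t, τ))) * β₀ (x 0) :=
    fun t => by rw [← lineAverage_chart 0, ← chart_comm 0]; rfl
  rw [integral_eq_integral_integral hη 0, ← mul_assoc, ← integral_mul_const]
  exact congrArg (· * β₁ (x 1)) (integral_congr_ae (Eventually.of_forall h))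

theorem exists_eq_lineDerivOp_add {η : Plane → ℝ} (hη : IsTest (box a b) η) {β₀ β₁ : ℝ → ℝ}
    (h₀ : IsProfile (a 0) (b 0) β₀) (h₁ : IsProfile (a 1) (b 1) β₁) :
    ∃ (E₀ E₁ : Plane → ℝ) (hE₀ : IsTest (box a b) E₀) (hE₁ : IsTest (box a b) E₁),
      hη.toPlaneTest = ∂_{e 0} hE₀.toPlaneTest + (∂_{e 1} hE₁.toPlaneTest +
        (∫ y, η y) • (isTest_mul_of_isProfile h₀ h₁).toPlaneTest) ∧
      (∀ x, fderiv ℝ E₀ x (e 0) = η x - lineAverage 0 β₀ η x) ∧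
      ∀ x, fderiv ℝ E₁ x (e 1) = lineAverage 0 β₀ η x - (∫ y, η y) * (β₀ (x 0) * β₁ (x 1)) := by
  obtain ⟨E₀, hE₀, hdE₀⟩ := hη.exists_fderiv_eq_sub_lineAverage h₀
  obtain ⟨E₁, hE₁, hdE₁⟩ := (hη.lineAverage h₀).exists_fderiv_eq_sub_lineAverage h₁
  simp only [lineAverage_lineAverage hη.integrable] at hdE₁
  refine ⟨E₀, E₁, hE₀, hE₁, TestFunction.ext fun x => ?_, hdE₀, hdE₁⟩
  change η x = (∂_{e 0} hE₀.toPlaneTest) x + ((∂_{e 1} hE₁.toPlaneTest) x +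
    (∫ y, η y) * (β₀ (x 0) * β₁ (x 1)))
  simp only [PlaneTest.lineDerivOp_apply, IsTest.coe_toPlaneTest, hdE₀, hdE₁]
  ring

/-- Up to derivatives, every test function is a multiple of a fixed one. -/
theorem exists_forall_eq_integral_mul (hab : ∀ k, a k < b k) (T : PlaneTest →ₗ[ℝ] ℝ)
    {u : Fin 2 → Plane → ℝ} (hu : ∀ i, Integrable (u i))
    (hT : ∀ i η (hη : IsTest (box a b) η),
      T (∂_{e i} hη.toPlaneTest) = ∫ x, fderiv ℝ η x (e i) * u i x) :
    ∃ g, IntegrableOn g (box a b) ∧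
      ∀ η (hη : IsTest (box a b) η), T hη.toPlaneTest = ∫ x, η x * g x := by
  obtain ⟨β₀, h₀⟩ := exists_isProfile (hab 0)
  obtain ⟨β₁, h₁⟩ := exists_isProfile (hab 1)
  have hB := isTest_mul_of_isProfile h₀ h₁
  set W := fun x => u 1 x - u 0 x
  have hW : Integrable W := (hu 1).sub (hu 0)
  set m := fun x : Plane => lineMoment 0 β₀ W (x (0 + 1))
  have hm : IntegrableOn m (box a b) := integrableOn_lineMoment hW h₀
  set C := T hB.toPlaneTest - ∫ x : Plane, β₀ (x 0) * β₁ (x 1) * u 1 x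
  have hC : IntegrableOn (fun _ : Plane => C) (box a b) :=
    (integrableOn_const isCompact_closedBox.measure_lt_top.ne).mono_set box_subset_closedBox
  refine ⟨fun x => u 0 x + m x + C, ((hu 0).integrableOn.add hm).add hC, fun η hη => ?_⟩
  obtain ⟨E₀, E₁, hE₀, hE₁, hdecomp, hdE₀, hdE₁⟩ := exists_eq_lineDerivOp_add hη h₀ h₁
  have hA := hη.lineAverage h₀
  set A := lineAverage 0 β₀ η
  have hi : ∀ {θ w : Plane → ℝ}, IsTest (box a b) θ → IntegrableOn w (box a b) →
      Integrable fun x => θ x * w x := fun hθ hw => hθ.integrable_smul hw.locallyIntegrableOn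
  have hi0 := hi hA (hu 0).integrableOn
  have hi1 := hi hA (hu 1).integrableOn
  have hmoment : ∫ x, η x * m x = (∫ x, A x * u 1 x) - ∫ x, A x * u 0 x := by
    rw [← integral_lineAverage_mul hη hW h₀]
    simp only [W, mul_sub]
    exact integral_sub hi1 hi0
  have hsum : ∫ x, η x * (u 0 x + m x + C) =
      (∫ x, η x * u 0 x) + (∫ x, η x * m x) + (∫ x, η x) * C := by
    simp only [mul_add]
    rw [integral_add ?_ (hi hη hC), integral_add (hi hη (hu 0).integrableOn) (hi hη hm),
      integral_mul_const]
    exact (hi hη (hu 0).integrableOn).add (hi hη hm)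
  rw [hsum, hmoment, hdecomp, map_add, map_add, map_smul, hT 0 _ hE₀, hT 1 _ hE₁, smul_eq_mul]
  simp only [hdE₀, hdE₁, sub_mul, mul_assoc (∫ y, η y)]
  rw [integral_sub (hi hη (hu 0).integrableOn) hi0,
    integral_sub hi1 ((hi hB (hu 1).integrableOn).const_mul _), integral_const_mul]
  ring

end Plane

/-! ### Integer-valued functions with prescribed vorticity -/

/-- The Heaviside step at `c`, normalised to vanish at `0`: then only finitely many of the steps at
the points of a locally finite set are non-zero near a given point. -/
noncomputable def stepFun (c t : ℝ) : ℤ := (if c < t then 1 else 0) - if c < 0 then 1 else 0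

theorem abs_le_of_stepFun_ne_zero {c t : ℝ} (h : stepFun c t ≠ 0) : |c| ≤ |t| := by
  contrapose! h
  obtain hc | hc := lt_or_ge c 0
  · rw [abs_of_neg hc] at h
    simp [stepFun, hc, show c < t by linarith [neg_abs_le t]]
  · rw [abs_of_nonneg hc] at h
    simp [stepFun, hc.not_gt, (le_abs_self t).trans h.le]

theorem measurable_stepFun (c : ℝ) : Measurable (stepFun c) :=
  (Measurable.ite measurableSet_Ioi measurable_const measurable_const).sub measurable_const

theorem abs_stepFun_le_one (c t : ℝ) : |stepFun c t| ≤ 1 := by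
  unfold stepFun
  split_ifs <;> simp

theorem integral_stepFun_mul_deriv {ζ : ℝ → ℝ} (hζ : ContDiff ℝ 1 ζ) (hζc : HasCompactSupport ζ)
    (c : ℝ) : ∫ t, stepFun c t * deriv ζ t = -ζ c := by
  have hd : Integrable (deriv ζ) :=
    (hζ.continuous_deriv le_rfl).integrable_of_hasCompactSupport hζc.deriv
  have h0 : ∫ t, deriv ζ t = 0 := integral_eq_zero_of_hasDerivAt_of_integrable
    (fun t => (hζ.differentiable one_ne_zero t).hasDerivAt) hd
    (hζ.continuous.integrable_of_hasCompactSupport hζc)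
  have hstep : ∀ t, stepFun c t * deriv ζ t =
      (Ioi c).indicator (deriv ζ) t - (if c < 0 then 1 else 0) * deriv ζ t := fun t => by
    simp only [stepFun, indicator, mem_Ioi]
    push_cast
    rw [sub_mul, ite_mul, one_mul, zero_mul]
  simp only [hstep]
  rw [integral_sub (hd.indicator measurableSet_Ioi) (hd.const_mul _), integral_const_mul, h0,
    mul_zero, sub_zero, integral_indicator measurableSet_Ioi, hζc.integral_Ioi_deriv_eq hζ]

namespace Plane

/-- The function `cornerFun y` equals `1` on the open quadrant with lower left corner `y`, up to
functions of one variable; hence `∂₀∂₁ (cornerFun y) = δ_y`. -/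
noncomputable def cornerFun (y x : Plane) : ℤ := stepFun (y 0) (x 0) * stepFun (y 1) (x 1)

theorem abs_le_of_cornerFun_ne_zero {y x : Plane} (h : cornerFun y x ≠ 0) (i : Fin 2) :
    |y i| ≤ |x i| := by
  fin_cases i
  exacts [abs_le_of_stepFun_ne_zero (left_ne_zero_of_mul h),
    abs_le_of_stepFun_ne_zero (right_ne_zero_of_mul h)]

theorem integrable_cornerFun_mul (y : Plane) {θ : Plane → ℝ} (hθ : Integrable θ) :
    Integrable fun x => cornerFun y x * θ x := by
  refine hθ.bdd_mul (c := 1) (Measurable.aestronglyMeasurable ?_)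
    (Eventually.of_forall fun x => ?_)
  · exact measurable_from_top.comp (((measurable_stepFun _).comp (by fun_prop)).mul
      ((measurable_stepFun _).comp (by fun_prop)))
  · rw [Real.norm_eq_abs, ← Int.cast_abs, cornerFun, abs_mul]
    exact_mod_cast mul_le_one₀ (abs_stepFun_le_one _ _) (abs_nonneg _) (abs_stepFun_le_one _ _)

/-- An integer-valued function `N` with `∂₀∂₁ N = ∑ k_y δ_y`, the sum being over a locally finite
set `V`. -/
noncomputable def vortexCount {V : Set Plane} (k : V → ℤ) (x : Plane) : ℤ :=
  ∑ᶠ y : V, k y * cornerFun y x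

end Plane

open Plane

theorem IsTest.integral_cornerFun_mul {Ω : Set Plane} {η : Plane → ℝ} (hη : IsTest Ω η)
    (y : Plane) :
    ∫ x, cornerFun y x * fderiv ℝ (fun x => fderiv ℝ η x (e 1)) x (e 0) = η y := by
  have h1 := hη.fderiv_apply (e 1)
  have hC1 : ∀ {θ : ℝ → ℝ}, ContDiff ℝ ∞ θ → ContDiff ℝ 1 θ := fun h =>
    h.of_le (by exact_mod_cast le_top)
  have hslice : ∀ s, ∫ t, cornerFun y (chart 0 (s, t)) *
      fderiv ℝ (fun x => fderiv ℝ η x (e 1)) (chart 0 (s, t)) (e 0) =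
      -(stepFun (y 1) s * deriv (fun t => η (chart 1 (y 0, t))) s) := fun s => by
    rw [hη.deriv_slice, ← zero_add (1 : Fin 2), chart_comm, zero_add, ← mul_neg,
      ← integral_stepFun_mul_deriv (hC1 (h1.contDiff_slice 0 s)) (h1.hasCompactSupport_slice 0 s),
      ← integral_const_mul]
    refine integral_congr_ae (Eventually.of_forall fun t => ?_)
    simp only [h1.deriv_slice, cornerFun, chart_apply, if_true, one_ne_zero, if_false]
    push_cast
    ring
  rw [integral_eq_integral_integral (integrable_cornerFun_mul y (h1.fderiv_apply (e 0)).integrable)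
    0]
  simp only [hslice]
  rw [integral_neg, integral_stepFun_mul_deriv (hC1 (hη.contDiff_slice 1 _))
    (hη.hasCompactSupport_slice 1 _), neg_neg]
  exact congrArg η (chart_coords 1 y)

namespace Plane

variable {V : Set Plane} (k : V → ℤ)

theorem exists_vortexCount_eq_sum (hV : ∀ K, IsCompact K → (V ∩ K).Finite) (M : ℝ) :
    ∃ A : Finset V, (∀ y : V, y.1 ∈ box (fun _ => -M) (fun _ => M) → y ∈ A) ∧
      ∀ x ∈ box (fun _ => -M) (fun _ => M), vortexCount k x = ∑ y ∈ A, k y * cornerFun y x := by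
  have hfin : {y : V | y.1 ∈ closedBox (fun _ => -M) (fun _ => M)}.Finite := by
    refine Set.Finite.of_finite_image (f := Subtype.val) ((hV _ (isCompact_closedBox
      (a := fun _ => -M) (b := fun _ => M))).subset ?_) Subtype.val_injective.injOn
    rintro _ ⟨y, hy, rfl⟩
    exact ⟨y.2, hy⟩
  refine ⟨hfin.toFinset, fun y hy => hfin.mem_toFinset.2 (box_subset_closedBox hy),
    fun x hx => finsum_eq_sum_of_support_subset _ fun y hy => ?_⟩
  rw [Finite.coe_toFinset]
  exact fun i => abs_le.1 <| (abs_le_of_cornerFun_ne_zero (right_ne_zero_of_mul hy) i).trans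
    (abs_lt.2 (hx i)).le

theorem locallyIntegrable_vortexCount (hV : ∀ K, IsCompact K → (V ∩ K).Finite) :
    LocallyIntegrable fun x => (vortexCount k x : ℝ) := by
  refine locallyIntegrable_iff.2 fun K hK => ?_
  obtain ⟨M, -, hM⟩ := exists_subset_box hK
  obtain ⟨A, -, hA⟩ := exists_vortexCount_eq_sum k hV M
  set χ := (box (fun _ => -M) fun _ => M).indicator fun _ : Plane => (1 : ℝ)
  have hχ : Integrable χ := (integrable_indicator_iff isOpen_box.measurableSet).2 <|
    (integrableOn_const isCompact_closedBox.measure_lt_top.ne).mono_set box_subset_closedBox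
  refine IntegrableOn.mono_set (IntegrableOn.congr_fun (f := fun x => ∑ y ∈ A, k y *
    (cornerFun y x * χ x)) ?_ (fun x hx => ?_) isOpen_box.measurableSet) hM
  · exact (integrable_finsetSum A fun (y : V) _ =>
      (integrable_cornerFun_mul y.1 hχ).const_mul (k y : ℝ)).integrableOn
  · simp [χ, hA x hx, hx]

theorem integral_vortexCount_mul {Ω : Set Plane} {η : Plane → ℝ} (hη : IsTest Ω η)
    (hV : ∀ K, IsCompact K → (V ∩ K).Finite) :
    ∫ x, vortexCount k x * fderiv ℝ (fun x => fderiv ℝ η x (e 1)) x (e 0) =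
      ∑ᶠ y : V, (k y : ℝ) * η y := by
  obtain ⟨M, -, hM⟩ := exists_subset_box hη.hasCompactSupport.isCompact
  replace hη : IsTest (box (fun _ => -M) fun _ => M) η := ⟨hη.contDiff, hη.hasCompactSupport, hM⟩
  obtain ⟨A, hAmem, hA⟩ := exists_vortexCount_eq_sum k hV M
  have hη2 := (hη.fderiv_apply (e 1)).fderiv_apply (e 0)
  have hsum : ∀ x, vortexCount k x * fderiv ℝ (fun x => fderiv ℝ η x (e 1)) x (e 0) =
      ∑ y ∈ A, k y * (cornerFun y x * fderiv ℝ (fun x => fderiv ℝ η x (e 1)) x (e 0)) :=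
    fun x => by
      by_cases hx : x ∈ box (fun _ => -M) fun _ => M
      · rw [hA x hx]
        push_cast
        simp only [Finset.sum_mul, mul_assoc]
      · simp only [hη2.eq_zero_of_notMem hx, mul_zero, Finset.sum_const_zero]
  simp only [hsum]
  rw [integral_finsetSum A fun (y : V) _ =>
    (integrable_cornerFun_mul y.1 hη2.integrable).const_mul (k y : ℝ),
    finsum_eq_sum_of_support_subset (s := A)]
  · simp only [integral_const_mul, hη.integral_cornerFun_mul]
  · intro y hy
    by_contra hne
    exact hy (by simp [hη.eq_zero_of_notMem (fun h => hne (hAmem y h))])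

end Plane

/-! ### Fields with potentials that are defined up to jumps -/

theorem exists_ae_glue {X E ι : Type*} [TopologicalSpace X] [SecondCountableTopology X]
    [MeasurableSpace X] [OpensMeasurableSpace X] {μ : Measure X} [NormedAddCommGroup E]
    {U : ι → Set X} (hU : ∀ i, IsOpen (U i)) {f : ι → X → E}
    (hf : ∀ i, LocallyIntegrableOn (f i) (U i) μ)
    (h : ∀ i j, ∀ᵐ z ∂μ, z ∈ U i → z ∈ U j → f i z = f j z) :
    ∃ F : X → E, LocallyIntegrableOn F (⋃ i, U i) μ ∧ ∀ i, ∀ᵐ z ∂μ, z ∈ U i → F z = f i z := by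
  classical
  obtain ⟨S, hS, hSU⟩ := TopologicalSpace.isOpen_iUnion_countable U hU
  have hsel : ∀ z, ∃ y : E, z ∈ ⋃ i, U i → ∃ i ∈ S, z ∈ U i ∧ y = f i z := fun z => by
    by_cases hz : z ∈ ⋃ i, U i
    · obtain ⟨i, hi, hzi⟩ := mem_iUnion₂.1 (hSU ▸ hz)
      exact ⟨f i z, fun _ => ⟨i, hi, hzi, rfl⟩⟩
    · exact ⟨0, fun h => absurd h hz⟩
  choose F hF using hsel
  have hFi : ∀ i, ∀ᵐ z ∂μ, z ∈ U i → F z = f i z := fun i => by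
    filter_upwards [(ae_ball_iff hS).2 fun j _ => h j i] with z hz hzi
    obtain ⟨j, hj, hzj, hFz⟩ := hF z (mem_iUnion_of_mem i hzi)
    rw [hFz, hz j hj hzj hzi]
  refine ⟨F, fun x hx => ?_, hFi⟩
  obtain ⟨i, hi⟩ := mem_iUnion.1 hx
  obtain ⟨s, hs, hfs⟩ := hf i x hi
  rw [(hU i).nhdsWithin_eq hi] at hs
  refine ⟨s ∩ U i, mem_nhdsWithin_of_mem_nhds (inter_mem hs ((hU i).mem_nhds hi)),
    (hfs.mono_set inter_subset_left).congr ?_⟩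
  filter_upwards [ae_restrict_of_ae_restrict_of_subset inter_subset_right
    ((ae_restrict_iff' (hU i).measurableSet).2 (hFi i))] with z hz using hz.symm

theorem ae_eq_of_forall_isTest_integral_eq {U : Set Plane} (hU : IsOpen U) {f g : Plane → ℝ}
    (hf : LocallyIntegrableOn f U) (hg : LocallyIntegrableOn g U)
    (h : ∀ η, IsTest U η → ∫ x, η x * f x = ∫ x, η x * g x) : ∀ᵐ z, z ∈ U → f z = g z := by
  refine (hU.ae_eq_zero_of_integral_contDiff_smul_eq_zero (hf.sub hg) fun η h1 h2 h3 => ?_).mono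
    fun z hz hm => sub_eq_zero.1 (hz hm)
  have hη : IsTest U η := ⟨h1, h2, h3⟩
  simp only [Pi.sub_apply, smul_sub]
  rw [integral_sub (hη.integrable_smul hf) (hη.integrable_smul hg)]
  exact sub_eq_zero.2 (h η hη)

theorem exists_forall_eq_integral_mul_of_locally (T : PlaneTest →ₗ[ℝ] ℝ) {Ω : Set Plane}
    (hT : ∀ x ∈ Ω, ∃ U, IsOpen U ∧ x ∈ U ∧ U ⊆ Ω ∧ ∃ f, LocallyIntegrableOn f U ∧
      ∀ η (hη : IsTest U η), T hη.toPlaneTest = ∫ x, η x * f x) :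
    ∃ F, LocallyIntegrableOn F Ω ∧
      ∀ η (hη : IsTest Ω η), T hη.toPlaneTest = ∫ x, η x * F x := by
  choose! U hU hxU hUΩ f hf hfT using hT
  obtain ⟨F, hF, hFf⟩ := exists_ae_glue (U := fun x : Ω => U x) (f := fun x : Ω => f x)
    (fun x => hU x x.2) (fun x => hf x x.2) fun x y => by
      refine (ae_eq_of_forall_isTest_integral_eq ((hU x x.2).inter (hU y y.2))
        ((hf x x.2).mono_set inter_subset_left) ((hf y y.2).mono_set inter_subset_right)
        fun η hη => ?_).mono fun z hz hx hy => hz ⟨hx, hy⟩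
      rw [← hfT x x.2 η (hη.mono inter_subset_left), ← hfT y y.2 η (hη.mono inter_subset_right)]
      rfl
  have hcover : ⋃ x : Ω, U x = Ω := (iUnion_subset fun x : Ω => hUΩ x x.2).antisymm
    fun x hx => mem_iUnion.2 ⟨⟨x, hx⟩, hxU x hx⟩
  rw [hcover] at hF
  refine ⟨F, hF, fun η hη => hη.induction_on_cover
    (P := fun ζ => ∀ hζ : IsTest univ ζ, T hζ.toPlaneTest = ∫ x, ζ x * F x) (fun x hx =>
      ⟨U x, hU x hx, hxU x hx, fun ζ hζ _ => ?_⟩) (fun _ => ?_) (fun ζ ξ hζ hξ ihζ ihξ _ => ?_)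
    (hη.mono (subset_univ _))⟩
  · refine (hfT x hx ζ hζ).trans (integral_congr_ae ?_)
    filter_upwards [hFf ⟨x, hx⟩] with z hz
    by_cases hzU : z ∈ U x
    · rw [hz hzU]
    · rw [hζ.eq_zero_of_notMem hzU, zero_mul, zero_mul]
  · simp only [Pi.zero_apply, zero_mul, integral_zero]
    exact map_zero T
  · have hsum := integral_add (hζ.integrable_smul hF) (hξ.integrable_smul hF)
    simp only [smul_eq_mul] at hsum
    simp only [Pi.add_apply, add_mul]
    rw [hsum, ← ihζ (hζ.mono (subset_univ _)), ← ihξ (hξ.mono (subset_univ _)), ← map_add]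
    rfl

namespace Plane

variable {a b : Fin 2 → ℝ} {Ω : Set Plane}

theorem exists_integrable_forall_integral_fderiv_mul (hab : ∀ k, a k < b k) {g : Plane → ℝ}
    (hg : IntegrableOn g (box a b)) (i : Fin 2) :
    ∃ u, Integrable u ∧
      ∀ η, IsTest (box a b) η → ∫ x, fderiv ℝ η x (e i) * u x = -∫ x, η x * g x := by
  have hG : Integrable ((box a b).indicator g) :=
    (integrable_indicator_iff isOpen_box.measurableSet).2 hg
  have hu := integrableOn_linePrimitive (a := a) (b := b) i hG
  refine ⟨(box a b).indicator (linePrimitive i ((box a b).indicator g)),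
    (integrable_indicator_iff isOpen_box.measurableSet).2 hu, fun η hη => ?_⟩
  simp only [(hη.fderiv_apply (e i)).mul_indicator]
  rw [integral_fderiv_mul_of_hasACRep hη hab hu hG.integrableOn
    (ae_restrict_of_ae (ae_hasACRep_linePrimitive hG i _ _))]
  simp only [hη.mul_indicator]

theorem exists_forall_hasWeakPartial_sub (hΩ : IsOpen Ω) (T : PlaneTest →ₗ[ℝ] ℝ)
    {N v : Fin 2 → Plane → ℝ} (hN : ∀ i, LocallyIntegrableOn (N i) Ω)
    (hv : ∀ i, LocallyIntegrableOn (v i) Ω)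
    (hT : ∀ i η (hη : IsTest Ω η), T (∂_{e i} hη.toPlaneTest) =
      (∫ x, fderiv ℝ η x (e i) * N i x) - ∫ x, η x * v i x) :
    ∃ F, LocallyIntegrableOn F Ω ∧
      ∀ i, HasWeakPartial Ω i (fun x => F x - N i x) (v i) := by
  obtain ⟨F, hF, hFT⟩ := exists_forall_eq_integral_mul_of_locally T (Ω := Ω) fun x hx => by
    obtain ⟨a, b, hxb, hsub⟩ := exists_mem_box_of_mem_isOpen hΩ hx
    have hab : ∀ k, a k < b k := fun k => (hxb k).1.trans (hxb k).2
    have hboxΩ : box a b ⊆ Ω := box_subset_closedBox.trans hsub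
    choose u hu huv using fun i => exists_integrable_forall_integral_fderiv_mul hab
      (integrableOn_box_of_closedBox_subset (hv i) hsub) i
    have hNbox := fun i => integrableOn_box_of_closedBox_subset (hN i) hsub
    obtain ⟨g, hg, hgT⟩ := exists_forall_eq_integral_mul hab T
      (u := fun i x => (box a b).indicator (N i) x + u i x)
      (fun i => ((integrable_indicator_iff isOpen_box.measurableSet).2 (hNbox i)).add (hu i))
      fun i η hη => by
        have hη' := hη.fderiv_apply (e i)
        refine (hT i η (hη.mono hboxΩ)).trans ?_
        simp only [mul_add, hη'.mul_indicator]
        have hsum := integral_add (hη'.integrable_smul (hNbox i).locallyIntegrableOn)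
          (hη'.integrable_smul (hu i).integrableOn.locallyIntegrableOn)
        simp only [smul_eq_mul] at hsum
        rw [hsum, huv i η hη, sub_eq_add_neg]
    exact ⟨box a b, isOpen_box, hxb, hboxΩ, g, hg.locallyIntegrableOn, hgT⟩
  refine ⟨F, hF, fun i => ⟨hF.sub (hN i), hv i, fun η h1 h2 h3 => ?_⟩⟩
  have hη : IsTest Ω η := ⟨h1, h2, h3⟩
  have hη' := hη.fderiv_apply (e i)
  have hFη : T (∂_{e i} hη.toPlaneTest) = ∫ x, fderiv ℝ η x (e i) * F x := by
    rw [← hFT _ hη']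
    exact congrArg T (DFunLike.ext _ _ fun x => PlaneTest.lineDerivOp_apply _ _ _)
  simp only [smul_sub]
  rw [integral_sub (hη'.integrable_smul hF) (hη'.integrable_smul (hN i))]
  simp only [smul_eq_mul]
  rw [← hFη, hT i η hη, sub_sub_cancel_left]

end Plane

/-! ### The phase of the wave function -/

theorem finite_inter_of_separated {X : Type*} [PseudoMetricSpace X] {V : Set X} {α : ℝ}
    (hα : 0 < α) (hV : ∀ x ∈ V, ∀ y ∈ V, x ≠ y → α ≤ dist x y) {K : Set X} (hK : IsCompact K) :
    (V ∩ K).Finite := by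
  obtain ⟨t, -, htf, ht⟩ := hK.finite_cover_balls (half_pos hα)
  refine (htf.biUnion (t := fun c => V ∩ Metric.ball c (α / 2)) fun c _ => ?_).subset
    fun x hx => ?_
  · refine Set.Subsingleton.finite fun x hx y hy => by_contra fun hne => ?_
    linarith [hV x hx.1 y hy.1 hne, dist_triangle_right x y c, Metric.mem_ball.1 hx.2,
      Metric.mem_ball.1 hy.2]
  · obtain ⟨c, hc, hxc⟩ := mem_iUnion₂.1 (ht hx.2)
    exact mem_iUnion₂.2 ⟨c, hc, hx.1, hxc⟩

theorem countable_of_finite_inter {X : Type*} [TopologicalSpace X] [SigmaCompactSpace X]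
    {V : Set X} (hV : ∀ K, IsCompact K → (V ∩ K).Finite) : V.Countable := by
  rw [← inter_univ V, ← iUnion_compactCovering, inter_iUnion]
  exact countable_iUnion fun n => (hV _ (isCompact_compactCovering X n)).countable

theorem ae_notMem_of_finite_inter {V : Set Plane} (hV : ∀ K, IsCompact K → (V ∩ K).Finite) :
    ∀ᵐ x, x ∉ V :=
  measure_eq_zero_iff_ae_notMem.1 ((countable_of_finite_inter hV).measure_zero _)

/-- `φ` is the phase `exp(iθ)` of a possibly multivalued potential `θ` of `v` on `Ω`, that is,
`φ` is unimodular and `∂ⱼ φ = i vⱼ φ` on `Ω`. -/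
structure IsPhase (Ω : Set Plane) (v : Plane → Plane) (φ : Plane → ℂ) : Prop where
  aestronglyMeasurable : AEStronglyMeasurable φ
  norm_eq_one : ∀ x, ‖φ x‖ = 1
  hasWeakPartial : ∀ j, HasWeakPartial Ω j φ fun x => v x j * (Complex.I * φ x)

theorem locallyIntegrableOn_of_norm_le {X E F : Type*} [TopologicalSpace X] [MeasurableSpace X]
    [NormedAddCommGroup E] [NormedAddCommGroup F] {μ : Measure X} {s : Set X} {f : X → E}
    {g : X → F} (hf : LocallyIntegrableOn f s μ) (hg : AEStronglyMeasurable g (μ.restrict s))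
    (h : ∀ x, ‖g x‖ ≤ ‖f x‖) : LocallyIntegrableOn g s μ := fun x hx => by
  obtain ⟨t, ht, hft⟩ := hf x hx
  exact ⟨t ∩ s, inter_mem ht self_mem_nhdsWithin, Integrable.mono
    (hft.mono_set inter_subset_left) (hg.mono_set inter_subset_right) (Eventually.of_forall h)⟩

theorem HasWeakPartial.cexp_mul_I {Ω : Set Plane} (hΩ : IsOpen Ω) {i : Fin 2} {u v : Plane → ℝ}
    (h : HasWeakPartial Ω i u v) :
    HasWeakPartial Ω i (fun x => Complex.exp (u x * Complex.I)) fun x =>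
      v x * (Complex.I * Complex.exp (u x * Complex.I)) := by
  have hderiv : ∀ t : ℝ, HasDerivAt (fun t : ℝ => Complex.exp (t * Complex.I))
      (Complex.I * Complex.exp (t * Complex.I)) t := fun t => by
    simpa [mul_comm] using (((hasDerivAt_id t).ofReal_comp).mul_const Complex.I).cexp
  have hLip : LipschitzOnWith 1 (fun t : ℝ => Complex.exp (t * Complex.I)) univ :=
    (lipschitzWith_of_nnnorm_deriv_le (fun t => (hderiv t).differentiableAt) fun t => by
      simp [(hderiv t).deriv]).lipschitzOnWith
  have hmeas : AEStronglyMeasurable (fun x => Complex.exp (u x * Complex.I))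
      (volume.restrict Ω) := (by fun_prop : Continuous fun y : ℝ => Complex.exp (y * Complex.I))
    |>.comp_aestronglyMeasurable h.locallyIntegrableOn.aestronglyMeasurable
  have hf : LocallyIntegrableOn (fun x => Complex.exp (u x * Complex.I)) Ω :=
    locallyIntegrableOn_of_norm_le ((locallyIntegrable_const (1 : ℝ)).locallyIntegrableOn Ω) hmeas
      fun x => by simp [Complex.norm_exp_ofReal_mul_I]
  have hg : LocallyIntegrableOn
      (fun x => v x • (Complex.I * Complex.exp (u x * Complex.I))) Ω :=
    locallyIntegrableOn_of_norm_le h.locallyIntegrableOn_deriv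
      (h.locallyIntegrableOn_deriv.aestronglyMeasurable.smul (hmeas.const_mul _))
      fun x => by simp [Complex.norm_exp_ofReal_mul_I]
  exact h.comp_of_lipschitzOnWith hΩ (Φ := fun t : ℝ => Complex.exp (t * Complex.I)) hf hg
    fun Q _ _ => ⟨univ, 1, isClosed_univ, mapsTo_univ _ _, hLip, fun y _ => hderiv y⟩

section Hydrodynamics

variable {r : Plane → ℝ} {Λ : Plane → Plane}

theorem isOpen_compl_vacuum (hr : Continuous r) : IsOpen (vacuum r)ᶜ :=
  (isClosed_singleton.preimage hr).isOpen_compl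

theorem locallyIntegrableOn_velocity (hr : Continuous r) (hΛ : LocallyIntegrable Λ) :
    LocallyIntegrableOn (velocity r Λ) (vacuum r)ᶜ := by
  have hcont : ContinuousOn (fun x => (r x ^ 2)⁻¹ * r x) (vacuum r)ᶜ :=
    ((hr.pow 2).continuousOn.inv₀ fun x hx => pow_ne_zero 2 hx).mul hr.continuousOn
  refine ((hΛ.locallyIntegrableOn _).continuousOn_smul
    (isOpen_compl_vacuum hr).isLocallyClosed hcont).congr (Eventually.of_forall fun x => ?_)
  exact mul_smul _ _ _

theorem exists_forall_eq_integral_fderiv_mul {f : Plane → ℝ} (hf : LocallyIntegrable f)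
    (w : Plane) :
    ∃ N : PlaneTest →ₗ[ℝ] ℝ, ∀ ζ, N ζ = ∫ x, fderiv ℝ ζ x w * f x := by
  refine ⟨(TestFunction.integralAgainstBilinCLM (ContinuousLinearMap.mul ℝ ℝ) volume
    f).toLinearMap ∘ₗ (TestFunction.lineDerivCLM ℝ w : PlaneTest →L[ℝ] PlaneTest).toLinearMap,
    fun ζ => ?_⟩
  refine (TestFunction.integralAgainstBilinCLM_eq_integral
    (hf.locallyIntegrableOn _)).trans (integral_congr_ae ?_)
  exact Eventually.of_forall fun x => congrArg (· * _) (PlaneTest.lineDerivOp_apply ζ w x)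

/-- The jumps account for the vorticity: `∂₀∂₁ vortexCount k = ∑ k_x δ_x`. -/
theorem HasQuantisedVorticity.exists_potential (hr : Continuous r) (hΛ : LocallyIntegrable Λ)
    (hV : ∀ K, IsCompact K → (vacuum r ∩ K).Finite) (h : HasQuantisedVorticity r Λ) :
    ∃ n : Fin 2 → Plane → ℤ, (∀ i, LocallyIntegrable fun x => (n i x : ℝ)) ∧
      ∃ T : PlaneTest →ₗ[ℝ] ℝ, ∀ i η (hη : IsTest (vacuum r)ᶜ η),
        T (∂_{e i} hη.toPlaneTest) =
          (∫ x, fderiv ℝ η x (e i) * (2 * Real.pi * n i x)) - ∫ x, η x * velocity r Λ x i := by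
  obtain ⟨v, hv, k, hk⟩ := h
  have hn := locallyIntegrable_vortexCount k hV
  let n : Fin 2 → Plane → ℤ := ![vortexCount k, 0]
  obtain ⟨N, hN⟩ := exists_forall_eq_integral_fderiv_mul (hn.smul (2 * Real.pi)) (e 0)
  let w (i : Fin 2) : PlaneTest →ₗ[ℝ] ℝ :=
    (EuclideanSpace.proj i : Plane →L[ℝ] ℝ).toLinearMap ∘ₗ v.toLinearMap
  obtain ⟨T, hT⟩ := PlaneTest.exists_potential ![w 0 - N, w 1] fun ζ => by
    have hvort := hk ζ
    rw [Distribution.lineDerivOp_apply_apply, Distribution.lineDerivOp_apply_apply, map_neg,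
      map_neg, ← integral_vortexCount_mul k ζ.isTest hV] at hvort
    have hN1 : N (∂_{e 1} ζ) = 2 * Real.pi *
        ∫ x, vortexCount k x * fderiv ℝ (fun x => fderiv ℝ ζ x (e 1)) x (e 0) := by
      rw [hN, ← integral_const_mul, funext (PlaneTest.lineDerivOp_apply ζ (e 1))]
      exact integral_congr_ae (Eventually.of_forall fun x => by
        simp only [Pi.smul_apply, smul_eq_mul]; ring)
    change v (∂_{e 1} ζ) 0 - N (∂_{e 1} ζ) = v (∂_{e 0} ζ) 1
    rw [hN1, ← hvort]
    simp
  have hw : ∀ i η (hη : IsTest (vacuum r)ᶜ η),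
      w i hη.toPlaneTest = ∫ x, η x * velocity r Λ x i := fun i η hη => by
    refine (congrArg (· i) (hv hη.toPlaneTest (disjoint_left.2 fun x hx =>
      hη.tsupport_subset hx))).trans ?_
    exact ((EuclideanSpace.proj i : Plane →L[ℝ] ℝ).integral_comp_comm
      (hη.integrable_smul (locallyIntegrableOn_velocity hr hΛ))).symm
  refine ⟨n, fun i => ?_, T, fun i η hη => ?_⟩
  · fin_cases i
    exacts [hn, by simpa [n] using locallyIntegrable_zero]
  · rw [hT, ← hw i η hη]
    fin_cases i
    · exact (neg_sub _ _).trans (congrArg (· - _) (hN _))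
    · simp [n]

theorem HasQuantisedVorticity.exists_isPhase (hr : Continuous r) (hΛ : LocallyIntegrable Λ)
    (hV : ∀ K, IsCompact K → (vacuum r ∩ K).Finite) (h : HasQuantisedVorticity r Λ) :
    ∃ φ, IsPhase (vacuum r)ᶜ (velocity r Λ) φ := by
  have hΩ := isOpen_compl_vacuum hr
  obtain ⟨n, hn, T, hT⟩ := h.exists_potential hr hΛ hV
  obtain ⟨F, hF, hFn⟩ := exists_forall_hasWeakPartial_sub hΩ T
    (N := fun i x => 2 * Real.pi * n i x) (v := fun i x => velocity r Λ x i)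
    (fun i => ((hn i).locallyIntegrableOn _).smul (2 * Real.pi))
    (fun i => locallyIntegrableOn_clm_comp (locallyIntegrableOn_velocity hr hΛ)
      (EuclideanSpace.proj i)) hT
  have hFm : AEStronglyMeasurable F := by
    rw [← Measure.restrict_eq_self_of_ae_mem (μ := volume) (s := (vacuum r)ᶜ)
      (ae_notMem_of_finite_inter hV)]
    exact hF.aestronglyMeasurable
  refine ⟨fun x => Complex.exp (F x * Complex.I), ?_, fun x => Complex.norm_exp_ofReal_mul_I _,
    fun j => ?_⟩
  · exact (by fun_prop : Continuous fun y : ℝ => Complex.exp (y * Complex.I))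
      |>.comp_aestronglyMeasurable hFm
  · have hexp : ∀ x, Complex.exp ((F x - 2 * Real.pi * n j x : ℝ) * Complex.I) =
        Complex.exp (F x * Complex.I) := fun x => by
      push_cast
      rw [sub_mul, mul_comm (2 * (Real.pi : ℂ)), mul_assoc]
      exact Complex.exp_periodic.sub_int_mul_eq _
    simpa only [hexp] using (hFn j).cexp_mul_I hΩ

end Hydrodynamics

/-! ### Mixed second derivatives -/

theorem exists_cutoff (E : Type*) [NormedAddCommGroup E] [InnerProductSpace ℝ E]
    [FiniteDimensional ℝ E] :
    ∃ (χ : ℕ → E → ℝ) (B : ℝ), (∀ n, ContDiff ℝ ∞ (χ n)) ∧ (∀ n, HasCompactSupport (χ n)) ∧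
      (∀ n x, ‖χ n x‖ ≤ 1) ∧ (∀ x, Tendsto (χ · x) atTop (𝓝 1)) ∧
      (∀ n x, ‖fderiv ℝ (χ n) x‖ ≤ B) ∧
      ∀ x, Tendsto (fun n => fderiv ℝ (χ n) x) atTop (𝓝 0) := by
  let β : ContDiffBump (0 : E) := ⟨1, 2, one_pos, one_lt_two⟩
  have hβ : ContDiff ℝ ∞ β := β.contDiff
  obtain ⟨B, hB⟩ := (β.hasCompactSupport.fderiv (𝕜 := ℝ)).exists_bound_of_continuous
    (hβ.continuous_fderiv (by simp))
  let c : ℕ → ℝ := fun n => 1 / ((n : ℝ) + 1)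
  have hc0 : ∀ n, 0 < c n := fun n => Nat.one_div_pos_of_nat
  have hc1 : ∀ n, ‖c n‖ ≤ 1 := fun n => by
    rw [Real.norm_of_nonneg (hc0 n).le, div_le_one (by positivity)]
    linarith [n.cast_nonneg (α := ℝ)]
  have hc : Tendsto c atTop (𝓝 0) := tendsto_one_div_add_atTop_nhds_zero_nat
  have hderiv : ∀ n x, fderiv ℝ (fun x => β (c n • x)) x = c n • fderiv ℝ β (c n • x) :=
    fun n x => fderiv_comp_smul (f := β) (c n)
  refine ⟨fun n x => β (c n • x), B, fun n => hβ.comp (contDiff_const_smul (c n)),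
    fun n => β.hasCompactSupport.comp_smul (hc0 n).ne', fun n x => ?_, fun x => ?_,
    fun n x => ?_, fun x => ?_⟩
  · rw [Real.norm_of_nonneg (β.nonneg' _)]
    exact β.le_one
  · have hlim := (hβ.continuous.tendsto _).comp (hc.smul_const x)
    rwa [zero_smul, β.one_of_mem_closedBall (Metric.mem_closedBall_self zero_le_one)] at hlim
  · rw [hderiv, norm_smul]
    exact (mul_le_of_le_one_left (norm_nonneg _) (hc1 n)).trans (hB _)
  · simp only [hderiv]
    exact hc.zero_smul_isBoundedUnder_le (isBoundedUnder_of ⟨B, fun n => hB _⟩)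

theorem tendsto_integral_smul_of_bounded {X E : Type*} [MeasurableSpace X] {μ : Measure X}
    [NormedAddCommGroup E] [NormedSpace ℝ E] {a : ℕ → X → ℝ} {A ℓ : ℝ} {w : X → E}
    (ha : ∀ n, AEStronglyMeasurable (a n) μ) (hA : ∀ n x, ‖a n x‖ ≤ A)
    (hlim : ∀ x, Tendsto (a · x) atTop (𝓝 ℓ)) (hw : Integrable w μ) :
    Tendsto (fun n => ∫ x, a n x • w x ∂μ) atTop (𝓝 (ℓ • ∫ x, w x ∂μ)) := by
  rw [← integral_smul]
  refine tendsto_integral_of_dominated_convergence (fun x => A * ‖w x‖)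
    (fun n => (ha n).smul hw.1) (hw.norm.const_mul A) (fun n => ?_) ?_
  · refine Eventually.of_forall fun x => (norm_smul_le _ _).trans ?_
    gcongr
    exact hA n x
  · exact Eventually.of_forall fun x => (hlim x).smul_const _

namespace HasWeakPartial

variable {𝕜 : Type*} [RCLike 𝕜] {Ω : Set Plane} {i : Fin 2} {f g f' g' : Plane → 𝕜}

theorem congr_ae (h : HasWeakPartial Ω i f g) (hf : f =ᵐ[volume] f') (hg : g =ᵐ[volume] g') :
    HasWeakPartial Ω i f' g' :=
  ⟨h.locallyIntegrableOn.congr (ae_restrict_of_ae hf),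
    h.locallyIntegrableOn_deriv.congr (ae_restrict_of_ae hg), fun η h1 h2 h3 => by
    rw [← integral_congr_ae (hf.mono fun x hx => congrArg (fderiv ℝ η x (e i) • ·) hx),
      ← integral_congr_ae (hg.mono fun x hx => congrArg (η x • ·) hx)]
    exact h.integral_eq η h1 h2 h3⟩

theorem integral_eq_zero (h : HasWeakPartial univ i f g) (hf : Integrable f)
    (hg : Integrable g) : ∫ x, g x = 0 := by
  obtain ⟨χ, B, hχ, hχc, hχ1, hχlim, hχB, hχlim'⟩ := exists_cutoff Plane
  have hlim := tendsto_integral_smul_of_bounded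
    (fun n => (hχ n).continuous.aestronglyMeasurable) hχ1 hχlim hg
  have hlim' := tendsto_integral_smul_of_bounded (w := f) (A := B * ‖e i‖)
    (a := fun n x => fderiv ℝ (χ n) x (e i)) (ℓ := 0)
    (fun n => (((hχ n).continuous_fderiv (by simp)).clm_apply
      continuous_const).aestronglyMeasurable)
    (fun n x => (fderiv ℝ (χ n) x).le_of_opNorm_le (hχB n x) _)
    (fun x => ((ContinuousLinearMap.apply ℝ ℝ (e i)).continuous.tendsto' _ _ (map_zero _)).comp
      (hχlim' x)) hf
  simp only [h.integral_eq _ (hχ _) (hχc _) (subset_univ _)] at hlim'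
  simpa using tendsto_nhds_unique hlim (by simpa using hlim'.neg)

theorem of_contDiff {u : Plane → 𝕜} (hu : ContDiff ℝ 1 u) :
    HasWeakPartial univ i u fun x => fderiv ℝ u x (e i) := by
  have hu' : Continuous fun x => fderiv ℝ u x (e i) :=
    (hu.continuous_fderiv one_ne_zero).clm_apply continuous_const
  refine ⟨hu.continuous.locallyIntegrable.locallyIntegrableOn _,
    hu'.locallyIntegrable.locallyIntegrableOn _, fun η hη hηc _ => ?_⟩
  have hη' : Continuous fun x => fderiv ℝ η x (e i) :=
    (hη.continuous_fderiv (by simp)).clm_apply continuous_const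
  rw [integral_smul_fderiv_eq_neg_fderiv_smul_of_integrable, neg_neg]
  · exact (hη'.smul hu.continuous).integrable_of_hasCompactSupport
      (hηc.fderiv_apply (𝕜 := ℝ) _).smul_right
  · exact (hη.continuous.smul hu').integrable_of_hasCompactSupport hηc.smul_right
  · exact (hη.continuous.smul hu.continuous).integrable_of_hasCompactSupport hηc.smul_right
  · exact fun x _ => hη.differentiable (by simp) x
  · exact fun x _ => hu.differentiable one_ne_zero x

end HasWeakPartial

section Fourier

open scoped SchwartzMap FourierTransform
open Complex (I)

theorem HasWeakPartial.iff_lineDerivOp {i : Fin 2} {f g : Lp ℂ 2 (volume : Measure Plane)} :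
    HasWeakPartial univ i f g ↔ ∂_{e i} (f : 𝓢'(Plane, ℂ)) = (g : 𝓢'(Plane, ℂ)) := by
  have hloc : ∀ F : Lp ℂ 2 (volume : Measure Plane), LocallyIntegrableOn F univ := fun F =>
    ((Lp.memLp F).locallyIntegrable one_le_two).locallyIntegrableOn _
  refine ⟨fun h => ?_, fun h => ⟨hloc f, hloc g, fun η hη hηc _ => ?_⟩⟩
  · ext η
    have hint : ∀ (ζ : 𝓢(Plane, ℂ)) (F : Lp ℂ 2 (volume : Measure Plane)),
        Integrable fun x => ζ x * F x := fun ζ F =>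
      memLp_one_iff_integrable.1 ((Lp.memLp F).mul (ζ.memLp 2 volume))
    have hd : ∀ x, fderiv ℝ η x (e i) = (∂_{e i} η : 𝓢(Plane, ℂ)) x := fun x =>
      (SchwartzMap.lineDerivOp_apply_eq_fderiv _ _ _).symm
    have hη := HasWeakPartial.of_contDiff (i := i) (η.smooth 1)
    simp only [hd] at hη
    have hsum := (hint (∂_{e i} η) f).add (hint η g)
    have hzero := (hη.mul isOpen_univ h ((hint η f).locallyIntegrable.locallyIntegrableOn _)
      (hsum.locallyIntegrable.locallyIntegrableOn _)).integral_eq_zero (hint η f) hsum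
    rw [integral_add (hint _ f) (hint _ g)] at hzero
    rw [TemperedDistribution.lineDerivOp_apply_apply, map_neg, Lp.toTemperedDistribution_apply,
      Lp.toTemperedDistribution_apply]
    exact neg_eq_of_add_eq_zero_right hzero
  · have hηc' : HasCompactSupport fun x => (η x : ℂ) := hηc.comp_left Complex.ofReal_zero
    have hη' : ContDiff ℝ ∞ fun x => (η x : ℂ) := Complex.ofRealCLM.contDiff.comp hη
    have key := congrArg (fun S : 𝓢'(Plane, ℂ) => S (hηc'.toSchwartzMap hη')) h
    have hd : ∀ x, (∂_{e i} (hηc'.toSchwartzMap hη') : 𝓢(Plane, ℂ)) x = fderiv ℝ η x (e i) :=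
      fun x => by
        rw [SchwartzMap.lineDerivOp_apply_eq_fderiv]
        exact congrArg (· (e i)) (Complex.ofRealCLM.hasFDerivAt.comp x
          (hη.differentiable (by simp) x).hasFDerivAt).fderiv
    simp only [TemperedDistribution.lineDerivOp_apply_apply, map_neg,
      Lp.toTemperedDistribution_apply, hd] at key
    exact neg_eq_iff_eq_neg.1 key

variable {E : Type*} [NormedAddCommGroup E] [InnerProductSpace ℝ E] [FiniteDimensional ℝ E]
  [MeasurableSpace E] [BorelSpace E]

theorem fourier_lineDerivOp_apply (m : E) (f : Lp ℂ 2 (volume : Measure E)) (η : 𝓢(E, ℂ)) :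
    𝓕 (∂_{m} (f : 𝓢'(E, ℂ))) η = ∫ ξ : E, η ξ *
      (2 * Real.pi * I * (inner ℝ ξ m : ℝ) * (𝓕 f : Lp ℂ 2 (volume : Measure E)) ξ) := by
  have htemp : Function.HasTemperateGrowth fun ξ : E => ((inner ℝ ξ m : ℝ) : ℂ) := by fun_prop
  rw [TemperedDistribution.fourier_lineDerivOp_eq, Lp.fourier_toTemperedDistribution_eq]
  change (2 * Real.pi * I) • TemperedDistribution.smulLeftCLM ℂ _ _ η = _
  rw [TemperedDistribution.smulLeftCLM_apply_apply, Lp.toTemperedDistribution_apply,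
    smul_eq_mul, ← integral_const_mul]
  refine integral_congr_ae (Eventually.of_forall fun ξ => ?_)
  simp only [SchwartzMap.smulLeftCLM_apply_apply htemp, smul_eq_mul]
  ring

theorem lineDerivOp_eq_iff_fourier_ae_eq {m : E} {f g : Lp ℂ 2 (volume : Measure E)} :
    ∂_{m} (f : 𝓢'(E, ℂ)) = (g : 𝓢'(E, ℂ)) ↔
      ∀ᵐ ξ : E, (𝓕 g : Lp ℂ 2 (volume : Measure E)) ξ =
        2 * Real.pi * I * (inner ℝ ξ m : ℝ) * (𝓕 f : Lp ℂ 2 (volume : Measure E)) ξ := by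
  have hinj : Function.Injective (𝓕 : 𝓢'(E, ℂ) → 𝓢'(E, ℂ)) :=
    Function.LeftInverse.injective (g := 𝓕⁻) FourierTransform.fourierInv_fourier_eq
  rw [← hinj.eq_iff, Lp.fourier_toTemperedDistribution_eq]
  refine ⟨fun h => ?_, fun h => ?_⟩
  · have hcont : Continuous fun ξ : E => 2 * Real.pi * I * (inner ℝ ξ m : ℝ) := by fun_prop
    have hloc : ∀ H : Lp ℂ 2 (volume : Measure E), LocallyIntegrable H := fun H =>
      (Lp.memLp H).locallyIntegrable one_le_two
    have hloc' := locallyIntegrableOn_univ.1 (((hloc (𝓕 f)).locallyIntegrableOn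
      univ).continuousOn_smul isOpen_univ.isLocallyClosed hcont.continuousOn)
    refine ae_eq_of_integral_contDiff_smul_eq (hloc _) hloc' fun η hη hηc => ?_
    have hη' : HasCompactSupport fun x => (η x : ℂ) := hηc.comp_left Complex.ofReal_zero
    have key := congrArg
      (fun S : 𝓢'(E, ℂ) => S (hη'.toSchwartzMap (Complex.ofRealCLM.contDiff.comp hη))) h
    simp only [fourier_lineDerivOp_apply, Lp.toTemperedDistribution_apply] at key
    exact key.symm
  · ext η
    rw [fourier_lineDerivOp_apply, Lp.toTemperedDistribution_apply]
    exact integral_congr_ae (h.mono fun ξ hξ => congrArg (η ξ * ·) hξ.symm)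

theorem eLpNorm_fourier_eq (f : Lp ℂ 2 (volume : Measure E)) :
    eLpNorm (𝓕 f : Lp ℂ 2 (volume : Measure E)) 2 volume = eLpNorm f 2 volume := by
  rw [← Lp.enorm_def, ← Lp.enorm_def, ← ofReal_norm, Lp.norm_fourier_eq, ofReal_norm]

theorem HasWeakPartial.iff_fourier {i : Fin 2} {f g : Plane → ℂ} (hf : MemLp f 2)
    (hg : MemLp g 2) : HasWeakPartial univ i f g ↔
      ∀ᵐ ξ : Plane, (𝓕 (hg.toLp g) : Lp ℂ 2 (volume : Measure Plane)) ξ =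
        2 * Real.pi * I * ξ i * (𝓕 (hf.toLp f) : Lp ℂ 2 (volume : Measure Plane)) ξ := by
  have hinner : ∀ ξ : Plane, inner ℝ ξ (e i) = ξ i := fun ξ => by
    simp [Plane.e, EuclideanSpace.inner_single_right]
  simp only [← hinner, ← lineDerivOp_eq_iff_fourier_ae_eq, ← HasWeakPartial.iff_lineDerivOp]
  exact ⟨fun h => h.congr_ae hf.coeFn_toLp.symm hg.coeFn_toLp.symm,
    fun h => h.congr_ae hf.coeFn_toLp hg.coeFn_toLp⟩

theorem norm_mul_le_norm_sq_add_norm_sq (s t z : ℂ) :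
    ‖s * (t * z)‖ ≤ ‖s * (s * z)‖ + ‖t * (t * z)‖ := by
  simp only [norm_mul]
  nlinarith [mul_nonneg (sq_nonneg (‖s‖ - ‖t‖)) (norm_nonneg z),
    mul_nonneg (sq_nonneg (‖s‖ + ‖t‖)) (norm_nonneg z)]

/-- On the Fourier side the mixed derivative is bounded by the pure ones, since
`|ξ₀ ξ₁| ≤ ξ₀² + ξ₁²`. -/
theorem exists_mixed_weakPartial {f : Plane → ℂ} {f₁ f₂ : Fin 2 → Plane → ℂ} (hf : MemLp f 2)
    (hf₁ : ∀ i, MemLp (f₁ i) 2) (hf₂ : ∀ i, MemLp (f₂ i) 2)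
    (h₁ : ∀ i, HasWeakPartial univ i f (f₁ i)) (h₂ : ∀ i, HasWeakPartial univ i (f₁ i) (f₂ i)) :
    ∃ g : Plane → ℂ, MemLp g 2 ∧ eLpNorm g 2 ≤ eLpNorm (f₂ 0) 2 + eLpNorm (f₂ 1) 2 ∧
      ∀ i, HasWeakPartial univ i (f₁ (i + 1)) g := by
  have hF₁ := fun i => (HasWeakPartial.iff_fourier hf (hf₁ i)).1 (h₁ i)
  have hF₂ := fun i => (HasWeakPartial.iff_fourier (hf₁ i) (hf₂ i)).1 (h₂ i)
  set F : Lp ℂ 2 (volume : Measure Plane) := 𝓕 (hf.toLp f)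
  set F₂ : Fin 2 → Lp ℂ 2 (volume : Measure Plane) := fun i => 𝓕 ((hf₂ i).toLp (f₂ i))
  let m : Plane → ℂ := fun ξ => 2 * Real.pi * I * ξ 0 * (2 * Real.pi * I * ξ 1 * F ξ)
  have hbound : ∀ᵐ ξ, ‖m ξ‖ ≤ ‖F₂ 0 ξ‖ + ‖F₂ 1 ξ‖ := by
    filter_upwards [hF₁ 0, hF₁ 1, hF₂ 0, hF₂ 1] with ξ h0 h1 h00 h11
    rw [h00, h11, h0, h1]
    exact norm_mul_le_norm_sq_add_norm_sq _ _ _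
  have hcont : ∀ j, Continuous fun ξ : Plane => 2 * Real.pi * I * (ξ j : ℂ) := fun j => by fun_prop
  have hm : MemLp m 2 := ((Lp.memLp (F₂ 0)).norm.add (Lp.memLp (F₂ 1)).norm).mono'
    ((hcont 0).aestronglyMeasurable.mul
      ((hcont 1).aestronglyMeasurable.mul (Lp.aestronglyMeasurable F))) hbound
  let G : Lp ℂ 2 (volume : Measure Plane) := 𝓕⁻ (hm.toLp m)
  have hG : (𝓕 G : Lp ℂ 2 (volume : Measure Plane)) =ᵐ[volume] m := by
    rw [FourierTransform.fourier_fourierInv_eq]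
    exact hm.coeFn_toLp
  refine ⟨G, Lp.memLp G, ?_, fun i => ?_⟩
  · have hnorm : ∀ i, eLpNorm (fun ξ => ‖F₂ i ξ‖) 2 volume = eLpNorm (f₂ i) 2 := fun i => by
      rw [eLpNorm_norm, eLpNorm_fourier_eq, eLpNorm_congr_ae (hf₂ i).coeFn_toLp]
    rw [← eLpNorm_fourier_eq, ← hnorm, ← hnorm, eLpNorm_congr_ae hG]
    exact (eLpNorm_mono_ae_real hbound).trans (eLpNorm_add_le (Lp.aestronglyMeasurable _).norm
      (Lp.aestronglyMeasurable _).norm one_le_two)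
  · rw [HasWeakPartial.iff_fourier (hf₁ (i + 1)) (Lp.memLp G), Lp.toLp_coeFn]
    filter_upwards [hG, hF₁ (i + 1)] with ξ hGξ hξ
    rw [hGξ, hξ]
    fin_cases i
    · rfl
    · exact mul_left_comm _ _ _

end Fourier

/-! ### The wave function -/

open Complex (I)

theorem lipschitzOnWith_inv {c : ℝ≥0} (hc : 0 < c) :
    LipschitzOnWith (c⁻¹ ^ 2) (fun y : ℝ => y⁻¹) {y | c ≤ |y|} :=
  LipschitzOnWith.of_dist_le_mul fun x (hx : c ≤ |x|) y (hy : c ≤ |y|) => by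
    have hc' : (0 : ℝ) < c := hc
    have hx0 : x ≠ 0 := abs_pos.1 (hc'.trans_le hx)
    have hy0 : y ≠ 0 := abs_pos.1 (hc'.trans_le hy)
    calc dist x⁻¹ y⁻¹ = |x|⁻¹ * |y|⁻¹ * dist x y := by
          rw [Real.dist_eq, inv_sub_inv hx0 hy0, abs_div, abs_mul, abs_sub_comm, Real.dist_eq]
          field_simp
      _ ≤ (c : ℝ)⁻¹ * (c : ℝ)⁻¹ * dist x y := by gcongr
      _ = _ := by push_cast; ring

theorem HasWeakPartial.inv {Ω : Set Plane} (hΩ : IsOpen Ω) {i : Fin 2} {u v : Plane → ℝ}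
    (h : HasWeakPartial Ω i u v) (hu : ContinuousOn u Ω) (hu0 : ∀ x ∈ Ω, u x ≠ 0) :
    HasWeakPartial Ω i (fun x => (u x)⁻¹) fun x => v x • -(u x ^ 2)⁻¹ := by
  have hinv : ContinuousOn (fun x => -(u x ^ 2)⁻¹) Ω :=
    ((hu.pow 2).inv₀ fun x hx => pow_ne_zero 2 (hu0 x hx)).neg
  refine h.comp_of_lipschitzOnWith hΩ (Φ := fun y => y⁻¹) (Φ' := fun y => -(y ^ 2)⁻¹)
    ((hu.inv₀ hu0).locallyIntegrableOn hΩ.measurableSet) ?_ fun Q hQ hQΩ => ?_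
  · refine (h.locallyIntegrableOn_deriv.continuousOn_smul hΩ.isLocallyClosed hinv).congr
      (Eventually.of_forall fun x => mul_comm _ _)
  · obtain ⟨c, hc, hcQ⟩ : ∃ c : ℝ≥0, 0 < c ∧ ∀ x ∈ Q, c ≤ |u x| := by
      obtain ⟨c, hc, hcQ⟩ := hQ.exists_forall_le' (hu.mono hQΩ).abs
        fun x hx => abs_pos.2 (hu0 x (hQΩ hx))
      exact ⟨⟨c, hc.le⟩, hc, hcQ⟩
    exact ⟨{y | c ≤ |y|}, _, isClosed_le continuous_const continuous_abs, hcQ,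
      lipschitzOnWith_inv hc, fun y hy => hasDerivAt_inv
        (abs_pos.1 ((NNReal.coe_pos.2 hc).trans_le hy))⟩

theorem HasWeakPartial.add_I_mul {Ω : Set Plane} {i : Fin 2} {f g f₁ g₁ : Plane → ℝ}
    (h : HasWeakPartial Ω i f g) (h₁ : HasWeakPartial Ω i f₁ g₁) :
    HasWeakPartial Ω i (fun x => (f x + I * f₁ x : ℂ)) fun x => g x + I * g₁ x :=
  HasWeakPartial.iff_re_im.2 ⟨by simpa using h, by simpa using h₁⟩

theorem locallyIntegrableOn_smul_mul {R : Type*} [NormedRing R] [NormedSpace ℝ R] {Ω : Set Plane}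
    (hΩ : IsOpen Ω) {c : Plane → ℝ} {f g : Plane → R} (hc : ContinuousOn c Ω) (hf : MemLp f 2)
    (hg : MemLp g 2) : LocallyIntegrableOn (fun x => c x • (f x * g x)) Ω := by
  have hfg := (hf.integrable_mul hg).locallyIntegrable.locallyIntegrableOn Ω
  exact hfg.continuousOn_smul hΩ.isLocallyClosed hc

theorem memLp_add_I_mul {a b : Plane → ℝ} (ha : MemLp a 2) (hb : MemLp b 2) :
    MemLp (fun x => (a x + I * b x : ℂ)) 2 := by
  have ha' : MemLp (fun x => (a x : ℂ)) 2 := ha.ofReal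
  have hb' : MemLp (fun x => (b x : ℂ)) 2 := hb.ofReal
  exact ha'.add (hb'.const_mul I)

theorem eLpNorm_add_I_mul_le {a b : Plane → ℝ} (ha : MemLp a 2) (hb : MemLp b 2) :
    eLpNorm (fun x => (a x + I * b x : ℂ)) 2 ≤ eLpNorm a 2 + eLpNorm b 2 := by
  rw [← eLpNorm_norm a, ← eLpNorm_norm b]
  refine (eLpNorm_mono_real fun x => (norm_add_le _ _).trans_eq ?_).trans
    (eLpNorm_add_le ha.1.norm hb.1.norm one_le_two)
  simp

theorem eLpNorm_euclidean_le_sum {ι : Type*} [Fintype ι] {u : Plane → EuclideanSpace ℂ ι}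
    (hu : MemLp u 2) : eLpNorm u 2 ≤ ∑ i, eLpNorm (fun x => u x i) 2 := by
  classical
  refine (eLpNorm_mono_real (g := ∑ i, fun x => ‖u x i‖) fun x => ?_).trans
    ((eLpNorm_sum_le (fun i _ => (hu.eval_piLp i).1.norm) one_le_two).trans_eq
      (Finset.sum_congr rfl fun i _ => eLpNorm_norm _))
  rw [← (EuclideanSpace.basisFun ι ℂ).sum_repr (u x)]
  exact (norm_sum_le _ _).trans_eq (by simp [norm_smul])

namespace IsPhase

variable {Ω : Set Plane} {v : Plane → Plane} {φ : Plane → ℂ} {f g : Plane → ℂ}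

theorem norm_mul_eq (hφ : IsPhase Ω v φ) (z : ℂ) (x : Plane) : ‖z * φ x‖ = ‖z‖ := by
  rw [norm_mul, hφ.norm_eq_one, mul_one]

theorem memLp_mul (hφ : IsPhase Ω v φ) (hf : MemLp f 2) : MemLp (fun x => f x * φ x) 2 :=
  hf.mono (hf.1.mul hφ.aestronglyMeasurable)
    (Eventually.of_forall fun x => (hφ.norm_mul_eq _ x).le)

theorem eLpNorm_mul (hφ : IsPhase Ω v φ) (f : Plane → ℂ) :
    eLpNorm (fun x => f x * φ x) 2 = eLpNorm f 2 :=
  eLpNorm_congr_norm_ae (Eventually.of_forall fun x => hφ.norm_mul_eq _ x)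

theorem hasWeakPartial_mul (hφ : IsPhase Ω v φ) (hΩ : IsOpen Ω) {j : Fin 2}
    (h : HasWeakPartial Ω j f g) (hfv : LocallyIntegrableOn (fun x => v x j * f x) Ω) :
    HasWeakPartial Ω j (fun x => f x * φ x) fun x => (g x + I * (v x j * f x)) * φ x := by
  have hmul : ∀ {w : Plane → ℂ}, LocallyIntegrableOn w Ω →
      LocallyIntegrableOn (fun x => w x * φ x) Ω := fun hw =>
    locallyIntegrableOn_of_norm_le hw (hw.aestronglyMeasurable.mul
      hφ.aestronglyMeasurable.restrict) fun x => (hφ.norm_mul_eq _ x).le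
  have hderiv : (fun x => g x * φ x + f x * (v x j * (I * φ x))) = fun x =>
      (g x + I * (v x j * f x)) * φ x := funext fun x => by ring
  have hgI : LocallyIntegrableOn (fun x => g x + I * (v x j * f x)) Ω :=
    h.locallyIntegrableOn_deriv.add (hfv.smul I)
  have := h.mul hΩ (hφ.hasWeakPartial j) (hmul h.locallyIntegrableOn)
  exact hderiv ▸ this (hderiv ▸ hmul hgI)

end IsPhase

theorem IsH1.exists_isH2 {f : Plane → ℂ} {Df : Plane → EuclideanSpace ℂ (Fin 2)}
    {s : Fin 2 → Plane → ℂ} (h : IsH1 f Df) (hs : ∀ j, MemLp (s j) 2)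
    (hw : ∀ j, HasWeakPartial univ j (fun x => Df x j) (s j)) :
    ∃ D2f : Plane → EuclideanSpace ℂ (Fin 2 × Fin 2),
      IsH2 f Df D2f ∧ eLpNorm D2f 2 ≤ 3 * (eLpNorm (s 0) 2 + eLpNorm (s 1) 2) := by
  obtain ⟨g, hg, hgs, hfg⟩ := exists_mixed_weakPartial h.memLp (fun j => h.memLp_grad.eval_piLp j)
    hs h.hasWeakPartial hw
  let D2f : Plane → EuclideanSpace ℂ (Fin 2 × Fin 2) := fun x =>
    WithLp.toLp 2 fun p => if p.2 = p.1 then s p.1 x else g x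
  have hdiag : ∀ i, (fun x => D2f x (i, i)) = s i := fun i => funext fun x => if_pos rfl
  have hoff : ∀ i, (fun x => D2f x (i, i + 1)) = g := fun i =>
    funext fun x => if_neg (add_one_ne i)
  have hD2f : MemLp D2f 2 := MemLp.of_eval_piLp <| by
    rintro ⟨i, j⟩
    obtain rfl | rfl := eq_or_eq_add_one i j
    exacts [hdiag j ▸ hs j, hoff i ▸ hg]
  refine ⟨D2f, ⟨h, hD2f, fun i j => ?_⟩, (eLpNorm_euclidean_le_sum hD2f).trans ?_⟩
  · obtain rfl | rfl := eq_or_eq_add_one i j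
    exacts [hdiag j ▸ hw j, hoff i ▸ hfg i]
  · rw [Fintype.sum_prod_type, Fin.sum_univ_two, Fin.sum_univ_two, Fin.sum_univ_two, hdiag, hdiag,
      show (fun x => D2f x (0, 1)) = g from hoff 0, show (fun x => D2f x (1, 0)) = g from hoff 1]
    calc _ = eLpNorm (s 0) 2 + eLpNorm (s 1) 2 + 2 * eLpNorm g 2 := by ring
      _ ≤ eLpNorm (s 0) 2 + eLpNorm (s 1) 2 + 2 * (eLpNorm (s 0) 2 + eLpNorm (s 1) 2) := by gcongr
      _ = _ := by ring

section WaveFunction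

variable {r : Plane → ℝ} {Dr Λ : Plane → Plane} {φ : Plane → ℂ} {j : Fin 2} {d m : Plane → ℝ}

theorem locallyIntegrableOn_velocity_mul (hr : Continuous r) (hΛ : MemLp Λ 2) {f : Plane → ℂ}
    (hf : MemLp f 2) :
    LocallyIntegrableOn (fun x => velocity r Λ x j * f x) (vacuum r)ᶜ := by
  have hΛj : MemLp (fun x => (Λ x j : ℂ)) 2 := (hΛ.eval_piLp j).ofReal
  have hcont : ContinuousOn (fun x => (r x ^ 2)⁻¹ * r x) (vacuum r)ᶜ :=
    ((hr.pow 2).continuousOn.inv₀ fun x hx => pow_ne_zero 2 hx).mul hr.continuousOn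
  refine (locallyIntegrableOn_smul_mul (isOpen_compl_vacuum hr) hcont hΛj hf).congr
    (Eventually.of_forall fun x => ?_)
  simp [velocity, momentum, mul_assoc]

theorem hasWeakPartial_of_momentum (hr : Continuous r) (h : IsH1 r Dr) (hΛ : MemLp Λ 2)
    (hr0 : ∀ᵐ x, x ∉ vacuum r)
    (hm : HasWeakPartial (vacuum r)ᶜ j (fun x => momentum r Λ x j) m) :
    HasWeakPartial (vacuum r)ᶜ j (fun x => Λ x j) fun x => (m x - Λ x j * Dr x j) / r x := by
  have hΩ := isOpen_compl_vacuum hr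
  have hinv : ContinuousOn (fun x => (r x)⁻¹) (vacuum r)ᶜ := hr.continuousOn.inv₀ fun _ hx => hx
  have hΛj := hΛ.eval_piLp j
  have hΛr : ∀ᵐ x, momentum r Λ x j * (r x)⁻¹ = Λ x j := hr0.mono fun x hx => by
    have hx : r x ≠ 0 := hx
    simp [momentum, hx, mul_right_comm]
  have hderiv : ∀ᵐ x, m x * (r x)⁻¹ + momentum r Λ x j * (Dr x j • -(r x ^ 2)⁻¹) =
      (m x - Λ x j * Dr x j) / r x := hr0.mono fun x hx => by
    have hx : r x ≠ 0 := hx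
    simp only [momentum, PiLp.smul_apply, smul_eq_mul]
    field_simp
    ring
  have hg : LocallyIntegrableOn (fun x => (m x - Λ x j * Dr x j) / r x) (vacuum r)ᶜ := by
    refine ((hm.locallyIntegrableOn_deriv.continuousOn_mul hinv hΩ.isLocallyClosed).sub
      (locallyIntegrableOn_smul_mul hΩ hinv hΛj (h.memLp_grad.eval_piLp j))).congr ?_
    exact Eventually.of_forall fun x => by simp only [Pi.sub_apply, smul_eq_mul]; ring
  refine (hm.mul hΩ (((h.hasWeakPartial j).mono (subset_univ _)).inv hΩ hr.continuousOn
    fun _ hx => hx) ?_ ?_).congr_ae hΛr hderiv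
  · exact ((hΛj.locallyIntegrable one_le_two).locallyIntegrableOn _).congr
      (ae_restrict_of_ae (hΛr.mono fun _ => Eq.symm))
  · exact hg.congr (ae_restrict_of_ae (hderiv.mono fun _ => Eq.symm))

/-- The gradient `(∇√ρ + iΛ) φ` of the wave function `√ρ φ`, where `Dr = ∇√ρ`. -/
noncomputable def waveGradient (Dr Λ : Plane → Plane) (φ : Plane → ℂ) (x : Plane) :
    EuclideanSpace ℂ (Fin 2) :=
  WithLp.toLp 2 fun j => (Dr x j + I * Λ x j) * φ x

namespace IsPhase

variable {Ω : Set Plane} {v : Plane → Plane}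

theorem mem_polarFactors (hφ : IsPhase Ω v φ) (hr : ∀ x, 0 ≤ r x) :
    φ ∈ polarFactors fun x => r x * φ x := by
  have hle : eLpNorm φ ∞ ≤ 1 := by
    rw [eLpNorm_exponent_top]
    exact eLpNormEssSup_le_of_ae_enorm_bound (Eventually.of_forall fun x => by
      rw [← ofReal_norm, hφ.norm_eq_one, ENNReal.ofReal_one])
  refine ⟨⟨hφ.aestronglyMeasurable, hle.trans_lt ENNReal.one_lt_top⟩, hle,
    Eventually.of_forall fun x => ?_⟩
  rw [hφ.norm_mul_eq, Complex.norm_of_nonneg (hr x)]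

theorem conj_mul_waveGradient (hφ : IsPhase Ω v φ) (Dr Λ : Plane → Plane) (x : Plane)
    (j : Fin 2) :
    (starRingEnd ℂ) (φ x) * waveGradient Dr Λ φ x j = Dr x j + I * Λ x j := by
  have hconj : (starRingEnd ℂ) (φ x) * φ x = 1 := by
    rw [Complex.conj_mul', hφ.norm_eq_one, Complex.ofReal_one, one_pow]
  simp only [waveGradient]
  rw [mul_left_comm, hconj, mul_one]

theorem eLpNorm_waveGradient_le (hφ : IsPhase Ω v φ) (hDr : MemLp Dr 2)
    (hΛ : MemLp Λ 2) :
    eLpNorm (waveGradient Dr Λ φ) 2 ≤ eLpNorm Dr 2 + eLpNorm Λ 2 := by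
  rw [← eLpNorm_norm Dr, ← eLpNorm_norm Λ]
  refine (eLpNorm_mono_real fun x => ?_).trans (eLpNorm_add_le hDr.1.norm hΛ.1.norm one_le_two)
  have hsq : ‖waveGradient Dr Λ φ x‖ ^ 2 = ‖Dr x‖ ^ 2 + ‖Λ x‖ ^ 2 := by
    simp only [EuclideanSpace.norm_sq_eq, ← Finset.sum_add_distrib, waveGradient, hφ.norm_mul_eq,
      mul_comm I, Complex.sq_norm, Complex.normSq_add_mul_I, Real.norm_eq_abs, sq_abs]
  refine le_of_sq_le_sq (hsq.trans_le ?_) (add_nonneg (norm_nonneg _) (norm_nonneg _))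
  simp only [Pi.add_apply]
  nlinarith [norm_nonneg (Dr x), norm_nonneg (Λ x)]

theorem isH1 (hφ : IsPhase (vacuum r)ᶜ (velocity r Λ) φ) (hr : Continuous r) (h : IsH1 r Dr)
    (hΛ : MemLp Λ 2) (hV : ∀ K, IsCompact K → (vacuum r ∩ K).Finite) :
    IsH1 (fun x => r x * φ x) (waveGradient Dr Λ φ) := by
  have hf : MemLp (fun x => (r x : ℂ)) 2 := h.memLp.ofReal
  have hψ := hφ.memLp_mul hf
  have hDψ : ∀ j, MemLp (fun x => waveGradient Dr Λ φ x j) 2 := fun j =>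
    hφ.memLp_mul (memLp_add_I_mul (h.memLp_grad.eval_piLp j) (hΛ.eval_piLp j))
  refine ⟨hψ, MemLp.of_eval_piLp hDψ, fun j => ?_⟩
  have hVc := hφ.hasWeakPartial_mul (isOpen_compl_vacuum hr)
    (((h.hasWeakPartial j).mono (subset_univ _)).clm_comp Complex.ofRealCLM)
    (locallyIntegrableOn_velocity_mul hr hΛ hf)
  refine (hVc.congr_ae ae_eq_rfl ((ae_notMem_of_finite_inter hV).mono fun x hx => ?_)).of_compl hV
    (isOpen_compl_iff.1 (isOpen_compl_vacuum hr)) (hψ.locallyIntegrable one_le_two)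
    ((hDψ j).locallyIntegrable one_le_two)
  have hx : (r x : ℂ) ≠ 0 := Complex.ofReal_ne_zero.2 hx
  simp only [waveGradient, velocity, momentum, PiLp.smul_apply, smul_eq_mul,
    Complex.ofRealCLM_apply, Complex.ofReal_mul, Complex.ofReal_inv, Complex.ofReal_pow]
  field_simp

theorem hasWeakPartial_waveGradient (hφ : IsPhase (vacuum r)ᶜ (velocity r Λ) φ)
    (hr : Continuous r) (h : IsH1 r Dr) (hΛ : MemLp Λ 2)
    (hV : ∀ K, IsCompact K → (vacuum r ∩ K).Finite)
    (hd : HasWeakPartial (vacuum r)ᶜ j (fun x => Dr x j) d)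
    (hm : HasWeakPartial (vacuum r)ᶜ j (fun x => momentum r Λ x j) m)
    (hd2 : MemLp (fun x => Λ x j ^ 2 / r x - d x) 2) (hm2 : MemLp (fun x => m x / r x) 2) :
    HasWeakPartial univ j (fun x => waveGradient Dr Λ φ x j) fun x =>
      ((-(Λ x j ^ 2 / r x - d x) : ℝ) + I * (m x / r x : ℝ)) * φ x := by
  have hr0 := ae_notMem_of_finite_inter hV
  have hf := memLp_add_I_mul (h.memLp_grad.eval_piLp j) (hΛ.eval_piLp j)
  have hVc := hφ.hasWeakPartial_mul (isOpen_compl_vacuum hr)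
    (hd.add_I_mul (hasWeakPartial_of_momentum hr h hΛ hr0 hm))
    (locallyIntegrableOn_velocity_mul hr hΛ hf)
  refine (hVc.congr_ae ae_eq_rfl (hr0.mono fun x hx => ?_)).of_compl hV
    (isOpen_compl_iff.1 (isOpen_compl_vacuum hr))
    ((hφ.memLp_mul hf).locallyIntegrable one_le_two)
    ((hφ.memLp_mul (memLp_add_I_mul hd2.neg hm2)).locallyIntegrable one_le_two)
  have hx : (r x : ℂ) ≠ 0 := Complex.ofReal_ne_zero.2 hx
  simp only [velocity, momentum, PiLp.smul_apply, smul_eq_mul]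
  push_cast
  field_simp
  ring_nf
  rw [Complex.I_sq]
  ring

theorem exists_isH2 (hφ : IsPhase (vacuum r)ᶜ (velocity r Λ) φ) (hr : Continuous r)
    (h : IsH1 r Dr) (hΛ : MemLp Λ 2) (hV : ∀ K, IsCompact K → (vacuum r ∩ K).Finite)
    {M : ℝ≥0}
    (hM : ∀ j : Fin 2, ∃ d m : Plane → ℝ,
      HasWeakPartial (vacuum r)ᶜ j (fun x => Dr x j) d ∧
      HasWeakPartial (vacuum r)ᶜ j (fun x => momentum r Λ x j) m ∧
      eLpNorm (fun x => Λ x j ^ 2 / r x - d x) 2 + eLpNorm (fun x => m x / r x) 2 ≤ M) :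
    ∃ D2ψ : Plane → EuclideanSpace ℂ (Fin 2 × Fin 2),
      IsH2 (fun x => r x * φ x) (waveGradient Dr Λ φ) D2ψ ∧ eLpNorm D2ψ 2 ≤ 6 * M := by
  choose d m hd hm hdm using hM
  have hr0 := ae_notMem_of_finite_inter hV
  have hd2 : ∀ j, MemLp (fun x => Λ x j ^ 2 / r x - d j x) 2 := fun j =>
    ⟨(((hΛ.eval_piLp j).1.pow 2).div₀ hr.aestronglyMeasurable).sub
      ((hd j).aestronglyMeasurable_deriv hr0),
      (le_self_add.trans (hdm j)).trans_lt ENNReal.coe_lt_top⟩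
  have hm2 : ∀ j, MemLp (fun x => m j x / r x) 2 := fun j =>
    ⟨((hm j).aestronglyMeasurable_deriv hr0).div₀ hr.aestronglyMeasurable,
      (le_add_self.trans (hdm j)).trans_lt ENNReal.coe_lt_top⟩
  obtain ⟨D2ψ, hD2ψ, hle⟩ := (hφ.isH1 hr h hΛ hV).exists_isH2
    (fun j => hφ.memLp_mul (memLp_add_I_mul (hd2 j).neg (hm2 j)))
    fun j => hφ.hasWeakPartial_waveGradient hr h hΛ hV (hd j) (hm j) (hd2 j) (hm2 j)
  have hsM : ∀ j, eLpNorm (fun x => ((-(Λ x j ^ 2 / r x - d j x) : ℝ) + I * (m j x / r x : ℝ)) *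
      φ x) 2 ≤ M := fun j => by
    have hneg : eLpNorm (fun x => -(Λ x j ^ 2 / r x - d j x)) 2 =
      eLpNorm (fun x => Λ x j ^ 2 / r x - d j x) 2 := eLpNorm_neg _ 2 volume
    rw [hφ.eLpNorm_mul]
    exact (eLpNorm_add_I_mul_le (hd2 j).neg (hm2 j)).trans (hneg ▸ hdm j)
  refine ⟨D2ψ, hD2ψ, hle.trans ?_⟩
  calc _ ≤ 3 * ((M : ℝ≥0∞) + M) := by gcongr; exacts [hsM 0, hsM 1]
    _ = 6 * M := by ring

end IsPhase

end WaveFunction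

theorem proposition3p1_general {r : Plane → ℝ} {Dr Λ : Plane → Plane} (hr0 : ∀ x, 0 ≤ r x)
    (h : IsH1 r Dr) (hΛ : MemLp Λ 2) (hr : Continuous r)
    (hV : ∀ K, IsCompact K → (vacuum r ∩ K).Finite) (hq : HasQuantisedVorticity r Λ) :
    ∃ (ψ : Plane → ℂ) (Dψ : Plane → EuclideanSpace ℂ (Fin 2)),
      IsH1 ψ Dψ ∧ (∀ᵐ x, r x = ‖ψ x‖) ∧
      (∃ φ ∈ polarFactors ψ, ∀ᵐ x, ∀ j : Fin 2, Λ x j = ((starRingEnd ℂ) (φ x) * Dψ x j).im) ∧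
      ∀ M₂ : ℝ≥0, (∀ j : Fin 2, ∃ d m : Plane → ℝ,
        HasWeakPartial (vacuum r)ᶜ j (fun x => Dr x j) d ∧
        HasWeakPartial (vacuum r)ᶜ j (fun x => momentum r Λ x j) m ∧
        eLpNorm (fun x => Λ x j ^ 2 / r x - d x) 2 + eLpNorm (fun x => m x / r x) 2 ≤ M₂) →
        ∃ D2ψ : Plane → EuclideanSpace ℂ (Fin 2 × Fin 2),
          IsH2 ψ Dψ D2ψ ∧ normH2 ψ Dψ D2ψ ≤ normH1 r Dr + eLpNorm Λ 2 + 6 * M₂ := by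
  obtain ⟨φ, hφ⟩ := hq.exists_isPhase hr (hΛ.locallyIntegrable one_le_two) hV
  have hnorm : ∀ x, ‖r x * φ x‖ = r x := fun x => by
    rw [hφ.norm_mul_eq, Complex.norm_of_nonneg (hr0 x)]
  refine ⟨fun x => r x * φ x, waveGradient Dr Λ φ, hφ.isH1 hr h hΛ hV,
    Eventually.of_forall fun x => (hnorm x).symm, ⟨φ, hφ.mem_polarFactors hr0,
      Eventually.of_forall fun x j => by simp [hφ.conj_mul_waveGradient]⟩, fun M₂ hM₂ => ?_⟩
  obtain ⟨D2ψ, hD2ψ, hle⟩ := hφ.exists_isH2 hr h hΛ hV hM₂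
  have hψ : eLpNorm (fun x => r x * φ x) 2 = eLpNorm r 2 :=
    eLpNorm_congr_norm_ae (Eventually.of_forall fun x => by
      rw [hnorm, Real.norm_of_nonneg (hr0 x)])
  refine ⟨D2ψ, hD2ψ, add_le_add ?_ hle⟩
  rw [hψ, normH1, add_assoc]
  gcongr
  exact hφ.eLpNorm_waveGradient_le h.memLp_grad hΛ

theorem proposition3p1 :
    ∃ C : ℝ≥0 → ℝ≥0 → ℝ≥0,
      ∀ (M₁ : ℝ≥0) (r : Plane → ℝ) (Dr Λ : Plane → Plane),
        (∀ x, 0 ≤ r x) →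
        IsH1 r Dr →
        MemLp Λ 2 volume →
        normH1 r Dr + eLpNorm Λ 2 volume ≤ M₁ →
        Continuous r →
        HasSeparatedPointVacuum r →
        HasQuantisedVorticity r Λ →
        ∃ (ψ : Plane → ℂ) (Dψ : Plane → EuclideanSpace ℂ (Fin 2)),
          IsH1 ψ Dψ ∧
          (∀ᵐ x, r x = ‖ψ x‖) ∧
          (∃ φ ∈ polarFactors ψ,
            ∀ᵐ x, ∀ j : Fin 2, Λ x j = ((starRingEnd ℂ) (φ x) * Dψ x j).im) ∧
          ∀ M₂ : ℝ≥0, HasHigherOrderBound r Dr Λ M₂ →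
            ∃ D2ψ : Plane → EuclideanSpace ℂ (Fin 2 × Fin 2),
              IsH2 ψ Dψ D2ψ ∧ normH2 ψ Dψ D2ψ ≤ C M₁ M₂ := by
  refine ⟨fun M₁ M₂ => M₁ + 6 * M₂, fun M₁ r Dr Λ hr0 h hΛ hM hr ⟨α, hα, hsep⟩ hq => ?_⟩
  obtain ⟨ψ, Dψ, hψ, hrψ, hφ, hH2⟩ := proposition3p1_general hr0 h hΛ hr
    (fun K hK => finite_inter_of_separated hα hsep hK) hq
  refine ⟨ψ, Dψ, hψ, hrψ, hφ, fun M₂ hM₂ => (hH2 M₂ hM₂.bound).imp fun D2ψ hD2ψ =>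
    ⟨hD2ψ.1, hD2ψ.2.trans ?_⟩⟩
  push_cast
  gcongr
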